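/- Let $p>q>0$ and, for $\delta\ge 0$, put $R(\delta)=p^{1+\delta}+q^{1+\delta}-1-(1+\delta)(p+q-1)$. Call a Borel probability measure $\mu$ on $[0,\infty)$ *normalized* if $\int v\,\mu(dv)=1$. For $\varphi\in C_c^\infty(\mathbb R)$ and a probability measure $\mu$ on $[0,\infty)$ put $$A_\varphi(\mu)=\iint\big(\varphi(pv+qw)-\varphi(v)\big)\,\mu(dv)\,\mu(dw)-(p+q-1)\int v\,\varphi'(v)\,\mu(dv).$$ A weak solution of the mean-rescaled wealth equation with initial datum $f_0$ is a family $(g(t))_{t\ge 0}$ of probability measures on $[0,\infty)$ with $g(0)=f_0$ such that for all $\varphi\in C_c^\infty(\mathbb R)$ one has $\lim_{t\downarrow 0}\int\varphi\,dg(t)=\int\varphi\,df_0$ and $\frac{d}{dt}\int\varphi\,dg(t)=A_\varphi(g(t))$ for $t>0$. A stationary solution is a probability measure $\mu$ on $[0,\infty)$ with $A_\varphi(\mu)=0$ for all $\varphi\in C_c^\infty(\mathbb R)$. For $s>0$ let $$d_s(\mu,\nu)=\sup_{\xi\ne 0}\frac{|\widehat\mu(\xi)-\widehat\nu(\xi)|}{|\xi|^s}\in[0,\infty],\qquad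 \widehat\mu(\xi)=\int e^{-i\xi v}\,\mu(dv).$$ **Theorem.** Let $\delta>0$ be such that $R(\delta)<0$. Then there is exactly one normalized stationary solution $g_\infty$, and $\int v^{1+\delta}\,g_\infty(dv)<\infty$. Moreover there is a constant $C$, depending only on $p$, $q$ and $\delta$, such that for every normalized $f_0$ with $\int v^{1+\delta}\,f_0(dv)<\infty$ there is exactly one weak solution $g$ with initial datum $f_0$, and for all $t\ge 0$ $$\int v^{1+\delta}\,g(t)(dv)\le\int v^{1+\delta}\,f_0(dv)+C,\qquad d_{1+\delta}(g(t),g_\infty)\le d_{1+\delta}(f_0,g_\infty)\,e^{-|R(\delta)|t}.$$ If $\delta\le 1$, then $d_{1+\delta}(f_0,g_\infty)<\infty$; for $\delta>1$ the second bound is to be read in $[0,\infty]$. -/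

import Mathlib

open MeasureTheory Set Filter Topology
open scoped ENNReal ContDiff

namespace WealthModel

/-- A test function: a smooth compactly supported function on the real line. -/
def IsTest (φ : ℝ → ℝ) : Prop :=
  ContDiff ℝ ∞ φ ∧ HasCompactSupport φ

/-- A law of wealth: a Borel probability measure carried by `[0, ∞)`. -/
def IsLaw (μ : Measure ℝ) : Prop :=
  IsProbabilityMeasure μ ∧ μ (Iio 0) = 0

/-- A law of wealth with mean `1`. -/
def IsNormalizedLaw (μ : Measure ℝ) : Prop :=
  IsLaw μ ∧ Integrable (fun v : ℝ => v) μ ∧ ∫ v, v ∂μ = 1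

/-- The law `μ` has a finite absolute moment of order `s`. -/
def HasMoment (s : ℝ) (μ : Measure ℝ) : Prop :=
  Integrable (fun v : ℝ => |v| ^ s) μ

/-- The absolute moment of order `s`. -/
noncomputable def moment (s : ℝ) (μ : Measure ℝ) : ℝ :=
  ∫ v, |v| ^ s ∂μ

/-- The right-hand side of the weak form of the mean-rescaled kinetic equation, tested on `φ`:
the trade term `∫∫ (φ(pv + qw) - φ(v)) μ(dv) μ(dw)` and the drift term
`(p + q - 1) ∫ φ ∂ᵥ(vμ) = -(p + q - 1) ∫ φ'(v) v μ(dv)` of the rescaling. -/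
noncomputable def weakRHS (p q : ℝ) (φ : ℝ → ℝ) (μ : Measure ℝ) : ℝ :=
  (∫ z : ℝ × ℝ, (φ (p * z.1 + q * z.2) - φ z.1) ∂(μ.prod μ))
    - (p + q - 1) * ∫ v, deriv φ v * v ∂μ

/-- `g` is a weak solution, for times `t ≥ 0`, of the mean-rescaled kinetic equation with initial
law `f₀`. (The values of `g` at negative times are irrelevant.) -/
structure IsWeakSolution (p q : ℝ) (f₀ : Measure ℝ) (g : ℝ → Measure ℝ) : Prop where
  isLaw : ∀ t, 0 ≤ t → IsLaw (g t)
  initial : g 0 = f₀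
  tendsto_initial : ∀ φ, IsTest φ →
    Tendsto (fun t => ∫ v, φ v ∂(g t)) (𝓝[>] 0) (𝓝 (∫ v, φ v ∂f₀))
  hasDerivAt : ∀ φ, IsTest φ → ∀ t, 0 < t →
    HasDerivAt (fun s => ∫ v, φ v ∂(g s)) (weakRHS p q φ (g t)) t

/-- `μ` is a stationary (time-independent) weak solution of the mean-rescaled equation. -/
def IsStationary (p q : ℝ) (μ : Measure ℝ) : Prop :=
  ∀ φ, IsTest φ → weakRHS p q φ μ = 0

/-- The Fourier transform `∫ exp(-iξv) μ(dv)`. -/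
noncomputable def fourierLaw (μ : Measure ℝ) (ξ : ℝ) : ℂ :=
  ∫ v : ℝ, Complex.exp (-Complex.I * (ξ : ℂ) * (v : ℂ)) ∂μ

/-- The Fourier metric `d_s`, with values in `[0, ∞]`. -/
noncomputable def fourierDist (s : ℝ) (μ ν : Measure ℝ) : ℝ≥0∞ :=
  ⨆ (ξ : ℝ) (_ : ξ ≠ 0), ENNReal.ofReal (‖fourierLaw μ ξ - fourierLaw ν ξ‖ / |ξ| ^ s)

/-- The function `R(δ) = p^(1+δ) + q^(1+δ) - 1 - (1+δ)(p + q - 1)`. -/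
noncomputable def rateR (p q δ : ℝ) : ℝ :=
  p ^ (1 + δ) + q ^ (1 + δ) - 1 - (1 + δ) * (p + q - 1)

end WealthModel

namespace WealthModel

/-! ### Test functions -/

/-! Write s = 1 + δ and ℓ = p + q - 1. Dilating g(t) by exp(ℓt) removes the drift. What remains is
m' = law(pV + qW) - m with V, W independent of law m. Everything is done for this equation and
transported back by `IsTradeFlow.isWeakSolution` and `IsWeakSolution.isTradeFlow`.

Existence is explicit. The Wild sum `wildSum` mixes the coefficients `wild` with the weights
exp(-t)(1 - exp(-t))^n, where coefficient n+1 is the average of the trade laws of coefficients i, j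
over the n+1 pairs with i + j = n. Uniqueness is a Picard iteration: the difference of two solutions
on test functions bounded by 1 is at most 2(3t)^n/n! for every n (`IsTradeFlow.eq`).

For the moments, (a+b)^s exceeds a^s + b^s only by mixed terms of orders 1 and s-1. The mean of the
Wild sum is exactly exp(ℓt), and the order s-1 is absorbed by a small multiple of the order s. This
gives y' ≤ (p^s + q^s - 1 + small) y + K exp(sℓt). Since p^s + q^s - 1 = sℓ + R(δ) with R(δ) < 0, y
grows at most like exp(sℓt), which the dilation cancels (`exists_moment_wealthFlow_le`).

In Fourier variables a trade is the product Φ(pξ)Φ(qξ). As |Φ| ≤ 1, the difference of two solutions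
is dominated by a solution of the linear equation W' = W(pξ) + W(qξ) - W(ξ)
(`IsFourierFlow.norm_sub_le_majorant`). The powers |ξ|^r are eigenfunctions; after rescaling, |ξ| is
conserved and |ξ|^s decays at rate |R(δ)|. This is the contraction estimate.

To obtain the stationary law, start at the Dirac mass at 1. The contraction, also between different
times, makes the transforms at integer times Cauchy, Lévy's theorem gives a limit law, and the
contraction shows that the flow fixes it. This needs an order at most 2, where equal means make the
initial distance finite. Convexity of R with R(0) = 0 allows δ to be lowered to min(δ, 1).
Uniqueness holds among all laws of mean one, with no higher moment: their transforms differ by at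
most a|ξ| + K|ξ|^s with a > 0 arbitrary, and the flow removes the second term. -/

/-- The generator `v φ'(v)` of dilations. -/
noncomputable def dilationGen (φ : ℝ → ℝ) (v : ℝ) : ℝ := deriv φ v * v

lemma IsTest.differentiable {φ : ℝ → ℝ} (hφ : IsTest φ) : Differentiable ℝ φ :=
  hφ.1.differentiable (by simp)

lemma IsTest.continuous {φ : ℝ → ℝ} (hφ : IsTest φ) : Continuous φ := hφ.1.continuous

lemma IsTest.dilationGen {φ : ℝ → ℝ} (hφ : IsTest φ) : IsTest (dilationGen φ) := by
  refine ⟨?_, ?_⟩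
  · have h : ContDiff ℝ ∞ (deriv φ) := (contDiff_infty_iff_deriv.1 hφ.1).2
    exact h.mul contDiff_id
  · exact HasCompactSupport.mul_right hφ.2.deriv

lemma IsTest.comp_affine {φ : ℝ → ℝ} (hφ : IsTest φ) {a : ℝ} (ha : a ≠ 0) (b : ℝ) :
    IsTest (fun v => φ (a * v + b)) := by
  refine ⟨hφ.1.comp (by fun_prop), ?_⟩
  have h := hφ.2.comp_homeomorph ((Homeomorph.mulLeft₀ a ha).trans (Homeomorph.addRight b))
  exact h

lemma IsTest.comp_mul {φ : ℝ → ℝ} (hφ : IsTest φ) {a : ℝ} (ha : a ≠ 0) :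
    IsTest (fun v => φ (a * v)) := by
  simpa using hφ.comp_affine ha 0

lemma IsTest.neg {φ : ℝ → ℝ} (hφ : IsTest φ) : IsTest (fun v => -φ v) :=
  ⟨hφ.1.neg, hφ.2.neg⟩

lemma IsTest.exists_bound {φ : ℝ → ℝ} (hφ : IsTest φ) : ∃ M, 0 < M ∧ ∀ v, |φ v| ≤ M := by
  obtain ⟨C, hC⟩ := hφ.2.exists_bound_of_continuous hφ.continuous
  exact ⟨max C 1, by positivity, fun v => (hC v).trans (le_max_left _ _)⟩

lemma integrable_of_bound {μ : Measure ℝ} [IsFiniteMeasure μ] {E : Type*} [NormedAddCommGroup E]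
    {F : ℝ → E} (hF : Continuous F) {M : ℝ} (hM : ∀ v, ‖F v‖ ≤ M) : Integrable F μ :=
  Integrable.of_bound hF.aestronglyMeasurable M (Eventually.of_forall hM)

lemma IsTest.integrable {φ : ℝ → ℝ} (hφ : IsTest φ) (μ : Measure ℝ) [IsFiniteMeasure μ] :
    Integrable φ μ := by
  obtain ⟨M, -, hM⟩ := hφ.exists_bound
  exact integrable_of_bound hφ.continuous hM

lemma deriv_comp_mul_mul (φ : ℝ → ℝ) (hφ : IsTest φ) (c v : ℝ) :
    deriv (fun v => φ (c * v)) v * v = dilationGen φ (c * v) := by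
  have h : HasDerivAt (fun v => φ (c * v)) (deriv φ (c * v) * c) v := by
    have h1 : HasDerivAt (fun v => c * v) c v := by simpa using (hasDerivAt_id v).const_mul c
    exact (hφ.differentiable (c * v)).hasDerivAt.comp v h1
  rw [h.deriv, dilationGen]; ring

lemma hasDerivAt_dilate {φ : ℝ → ℝ} (hφ : IsTest φ) (v a : ℝ) :
    HasDerivAt (fun a => φ (Real.exp a * v)) (dilationGen φ (Real.exp a * v)) a := by
  have h1 : HasDerivAt (fun a => Real.exp a * v) (Real.exp a * v) a :=
    (Real.hasDerivAt_exp a).mul_const v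
  exact (hφ.differentiable _).hasDerivAt.comp a h1

/-- Dilating a test function changes it by at most a multiple of the dilation parameter. -/
lemma abs_dilate_sub_le {φ : ℝ → ℝ} (hφ : IsTest φ) {L : ℝ} (hL : ∀ v, |dilationGen φ v| ≤ L)
    (v a : ℝ) : |φ (Real.exp a * v) - φ v| ≤ L * |a| := by
  have := Convex.norm_image_sub_le_of_norm_hasDerivWithin_le (s := univ) (C := L) (x := 0) (y := a)
    (fun x _ => (hasDerivAt_dilate hφ v x).hasDerivWithinAt) (fun x _ => hL _) convex_univ
    (mem_univ _) (mem_univ _)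
  simpa using this

/-- First-order expansion of a dilated test function, uniformly on the line. -/
lemma abs_dilate_sub_sub_le {φ : ℝ → ℝ} (hφ : IsTest φ) {L : ℝ}
    (hL : ∀ v, |dilationGen (dilationGen φ) v| ≤ L) (v a : ℝ) :
    |φ (Real.exp a * v) - φ v - a * dilationGen φ v| ≤ L * a ^ 2 := by
  have hL0 : 0 ≤ L := (abs_nonneg _).trans (hL 0)
  have := Convex.norm_image_sub_le_of_norm_hasDerivWithin_le (s := uIcc 0 a) (C := L * |a|)
    (x := 0) (y := a) (f := fun x => φ (Real.exp x * v) - x * dilationGen φ v)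
    (f' := fun x => dilationGen φ (Real.exp x * v) - dilationGen φ v)
    (fun x _ => ?_) (fun x hx => ?_) (convex_uIcc _ _)
    left_mem_uIcc right_mem_uIcc
  · rw [← sq_abs a, pow_two, ← mul_assoc]
    simp only [sub_zero, Real.norm_eq_abs, Real.exp_zero, one_mul, zero_mul] at this
    convert this using 2
    ring
  · refine ((hasDerivAt_dilate hφ v x).sub ?_).hasDerivWithinAt
    simpa using (hasDerivAt_id x).mul_const (dilationGen φ v)
  · refine (abs_dilate_sub_le hφ.dilationGen hL v x).trans ?_
    refine mul_le_mul_of_nonneg_left ?_ hL0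
    simpa only [sub_zero] using abs_sub_left_of_mem_uIcc hx

/-- Chain rule for a family of laws tested against a dilating test function. -/
lemma hasDerivAt_integral_dilate {m : ℝ → Measure ℝ} {B : (ℝ → ℝ) → ℝ} {t c : ℝ} (ht : 0 < t)
    (hm : ∀ s, 0 ≤ s → IsProbabilityMeasure (m s))
    (hB : ∀ φ, IsTest φ → HasDerivAt (fun s => ∫ v, φ v ∂(m s)) (B φ) t)
    {φ : ℝ → ℝ} (hφ : IsTest φ) :
    HasDerivAt (fun s => ∫ v, φ (Real.exp (c * s) * v) ∂(m s))
      (B (fun v => φ (Real.exp (c * t) * v))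
        + c * ∫ v, deriv (fun v => φ (Real.exp (c * t) * v)) v * v ∂(m t)) t := by
  set ψ : ℝ → ℝ := fun v => φ (Real.exp (c * t) * v) with hψdef
  have hψ : IsTest ψ := hφ.comp_mul (Real.exp_pos _).ne'
  obtain ⟨L, hLpos, hL⟩ := hψ.dilationGen.dilationGen.exists_bound
  -- Both the law and the test function move. The test function is replaced by its first-order
  -- expansion in the dilation parameter, whose coefficients are fixed test functions. The remainder
  -- is O((s - t)^2) uniformly in v, so it does not affect the derivative at t.
  have hmain : HasDerivAt (fun s => (∫ v, ψ v ∂(m s))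
      + c * (s - t) * ∫ v, dilationGen ψ v ∂(m s))
      (B ψ + c * ∫ v, dilationGen ψ v ∂(m t)) t := by
    have h1 : HasDerivAt (fun s : ℝ => c * (s - t)) c t := by
      simpa using ((hasDerivAt_id t).sub_const t).const_mul c
    exact ((hB ψ hψ).add (h1.mul (hB _ hψ.dilationGen))).congr_deriv (by simp)
  have hrem : HasDerivAt (fun s => (∫ v, φ (Real.exp (c * s) * v) ∂(m s))
      - ((∫ v, ψ v ∂(m s)) + c * (s - t) * ∫ v, dilationGen ψ v ∂(m s))) 0 t := by
    have hbd : ∀ s, 0 ≤ s → |(∫ v, φ (Real.exp (c * s) * v) ∂(m s))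
      - ((∫ v, ψ v ∂(m s)) + c * (s - t) * ∫ v, dilationGen ψ v ∂(m s))|
        ≤ L * c ^ 2 * (s - t) ^ 2 := by
      intro s hs
      have := hm s hs
      have i1 : Integrable (fun v => φ (Real.exp (c * s) * v)) (m s) :=
        (hφ.comp_mul (Real.exp_pos _).ne').integrable _
      have i2 := hψ.integrable (m s)
      have i3 := (hψ.dilationGen.integrable (m s)).const_mul (c * (s - t))
      have i4 : Integrable (fun v => ψ v + c * (s - t) * dilationGen ψ v) (m s) := i2.add i3
      rw [← integral_const_mul, ← integral_add i2 i3, ← integral_sub i1 i4,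
        ← Real.norm_eq_abs]
      refine (norm_integral_le_of_norm_le_const (C := L * c ^ 2 * (s - t) ^ 2)
        (Eventually.of_forall fun v => ?_)).trans (by simp)
      have h := abs_dilate_sub_sub_le hψ hL v (c * (s - t))
      have he : ψ (Real.exp (c * (s - t)) * v) = φ (Real.exp (c * s) * v) := by
        simp only [hψdef]
        rw [← mul_assoc, ← Real.exp_add]; ring_nf
      rw [he] at h
      calc _ = |φ (Real.exp (c * s) * v) - ψ v - c * (s - t) * dilationGen ψ v| := by
            rw [Real.norm_eq_abs]; ring_nf
        _ ≤ _ := h.trans (by rw [mul_pow, mul_assoc])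
    have h0 : (∫ v, φ (Real.exp (c * t) * v) ∂(m t))
      - ((∫ v, ψ v ∂(m t)) + c * (t - t) * ∫ v, dilationGen ψ v ∂(m t)) = 0 := by
      simp [hψdef]
    rw [hasDerivAt_iff_isLittleO, h0]
    simp only [sub_zero, smul_zero]
    refine Asymptotics.IsBigO.trans_isLittleO (g := fun s => (s - t) ^ 2) ?_ ?_
    · refine Asymptotics.IsBigO.of_bound (L * c ^ 2) ?_
      filter_upwards [lt_mem_nhds ht] with s hs
      simpa using hbd s hs.le
    · simp_rw [pow_two]
      have : Tendsto (fun s => s - t) (𝓝 t) (𝓝 0) := by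
        have : ContinuousAt (fun s => s - t) t := by fun_prop
        simpa [ContinuousAt] using this
      simpa using ((Asymptotics.isLittleO_one_iff ℝ).2 this).mul_isBigO
        (Asymptotics.isBigO_refl (fun s => s - t) (𝓝 t))
  have h := hmain.add hrem
  rw [add_zero] at h
  exact h.congr_of_eventuallyEq (Eventually.of_forall fun s => by simp)

lemma tendsto_integral_dilate {m : ℝ → Measure ℝ} {c ℓ : ℝ}
    (hm : ∀ s, 0 ≤ s → IsProbabilityMeasure (m s)) {φ : ℝ → ℝ} (hφ : IsTest φ)
    (h : Tendsto (fun s => ∫ v, φ v ∂(m s)) (𝓝[>] 0) (𝓝 ℓ)) :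
    Tendsto (fun s => ∫ v, φ (Real.exp (c * s) * v) ∂(m s)) (𝓝[>] 0) (𝓝 ℓ) := by
  obtain ⟨L, hLpos, hL⟩ := hφ.dilationGen.exists_bound
  have h2 : Tendsto (fun s => (∫ v, φ (Real.exp (c * s) * v) ∂(m s)) - ∫ v, φ v ∂(m s))
      (𝓝[>] 0) (𝓝 0) := by
    refine squeeze_zero_norm' (a := fun s => L * |c * s|) ?_ ?_
    · filter_upwards [self_mem_nhdsWithin] with s hs
      have := hm s (le_of_lt hs)
      rw [← integral_sub ((hφ.comp_mul (Real.exp_pos _).ne').integrable _) (hφ.integrable _)]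
      exact (norm_integral_le_of_norm_le_const (Eventually.of_forall fun v =>
        abs_dilate_sub_le hφ hL v (c * s))).trans (by simp)
    · have : ContinuousAt (fun s => L * |c * s|) 0 := by fun_prop
      have h3 : Tendsto (fun s => L * |c * s|) (𝓝 0) (𝓝 0) := by simpa [ContinuousAt] using this
      exact h3.mono_left nhdsWithin_le_nhds
  simpa using h.add h2

/-- Finite measures on the line which agree on test functions are equal. -/
lemma ext_of_isTest {μ ν : Measure ℝ} [IsFiniteMeasure μ] [IsFiniteMeasure ν]
    (h : ∀ φ, IsTest φ → (∀ v, |φ v| ≤ 1) → ∫ v, φ v ∂μ = ∫ v, φ v ∂ν) : μ = ν := by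
  refine Measure.ext_of_Icc μ ν fun a b hab => ?_
  -- Bumps equal to 1 on a neighbourhood of [a, b] and vanishing at distance 1/(n+1) outside it, so
  -- that they converge pointwise to the indicator of the closed interval.
  let f (n : ℕ) : ContDiffBump ((a + b) / 2) :=
    ⟨(b - a) / 2 + 1 / (2 * ((n : ℝ) + 1)), (b - a) / 2 + 1 / ((n : ℝ) + 1),
      by have : 0 < 1 / (2 * ((n : ℝ) + 1)) := by positivity
         linarith,
      by have : 1 / (2 * ((n : ℝ) + 1)) < 1 / ((n : ℝ) + 1) := by
           apply one_div_lt_one_div_of_lt <;> linarith [(Nat.cast_nonneg n : (0:ℝ) ≤ n)]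
         linarith⟩
  have hlim : ∀ (ρ : Measure ℝ) [IsFiniteMeasure ρ],
      Tendsto (fun n => ∫ v, f n v ∂ρ) atTop (𝓝 (ρ.real (Icc a b))) := by
    intro ρ _
    rw [← integral_indicator_one measurableSet_Icc]
    refine tendsto_integral_of_dominated_convergence (fun _ => 1)
      (fun n => (f n).continuous.aestronglyMeasurable) (integrable_const _)
      (fun n => Eventually.of_forall fun v => ?_) (Eventually.of_forall fun v => ?_)
    · rw [Real.norm_eq_abs, abs_of_nonneg (f n).nonneg]; exact (f n).le_one
    · by_cases hv : v ∈ Icc a b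
      · refine tendsto_const_nhds.congr fun n => ?_
        rw [indicator_of_mem hv, (f n).one_of_mem_closedBall]
        · rfl
        · have : 0 < 1 / (2 * ((n : ℝ) + 1)) := by positivity
          rw [Metric.mem_closedBall, Real.dist_eq, abs_le]
          simp only [f]
          constructor <;> linarith [hv.1, hv.2]
      · rw [indicator_of_notMem hv]
        have hd : (b - a) / 2 < |v - (a + b) / 2| := by
          by_contra! hcon
          rw [abs_le] at hcon
          exact hv ⟨by linarith [hcon.1], by linarith [hcon.2]⟩
        have h0 := (tendsto_one_div_add_atTop_nhds_zero_nat (𝕜 := ℝ)).const_add ((b - a) / 2)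
        rw [add_zero] at h0
        refine tendsto_const_nhds.congr' ?_
        filter_upwards [h0.eventually (gt_mem_nhds hd)] with n hn
        exact ((f n).zero_of_le_dist (by rw [Real.dist_eq]; exact hn.le)).symm
  have heq : μ.real (Icc a b) = ν.real (Icc a b) := by
    refine tendsto_nhds_unique (hlim μ) ((hlim ν).congr fun n => ?_)
    refine (h (f n) ⟨(f n).contDiff, (f n).hasCompactSupport⟩ fun v => ?_).symm
    rw [abs_of_nonneg (f n).nonneg]; exact (f n).le_one
  exact (measureReal_eq_measureReal_iff (by finiteness) (by finiteness)).1 heq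

/-! ### The equation without drift -/

/-- The image of a measure under multiplication by `exp a`. -/
noncomputable def dilate (a : ℝ) (μ : Measure ℝ) : Measure ℝ := μ.map (fun v => Real.exp a * v)

lemma measurable_exp_mul (a : ℝ) : Measurable (fun v : ℝ => Real.exp a * v) := by fun_prop

instance isProbabilityMeasure_dilate (a : ℝ) (μ : Measure ℝ) [IsProbabilityMeasure μ] :
    IsProbabilityMeasure (dilate a μ) :=
  Measure.isProbabilityMeasure_map (measurable_exp_mul a).aemeasurable

lemma dilate_dilate (a b : ℝ) (μ : Measure ℝ) : dilate a (dilate b μ) = dilate (a + b) μ := by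
  rw [dilate, dilate, Measure.map_map (measurable_exp_mul a) (measurable_exp_mul b), dilate]
  congr 1
  ext v
  simp [Real.exp_add, mul_assoc]

lemma dilate_zero (μ : Measure ℝ) : dilate 0 μ = μ := by simp [dilate]

/-- Multiplication by a nonzero number is a measurable embedding, hence no measurability of `F` is
required. -/
lemma integral_dilate {E : Type*} [NormedAddCommGroup E] [NormedSpace ℝ E] (a : ℝ) (μ : Measure ℝ)
    (F : ℝ → E) : ∫ v, F v ∂(dilate a μ) = ∫ v, F (Real.exp a * v) ∂μ := by
  have h : MeasurableEmbedding (fun v : ℝ => Real.exp a * v) :=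
    (Homeomorph.mulLeft₀ (Real.exp a) (Real.exp_pos a).ne').measurableEmbedding
  exact h.integral_map F

lemma integral_dilate_prod (a : ℝ) (μ : Measure ℝ) [SFinite μ] (F : ℝ × ℝ → ℝ) :
    ∫ z, F z ∂((dilate a μ).prod (dilate a μ))
      = ∫ z : ℝ × ℝ, F (Real.exp a * z.1, Real.exp a * z.2) ∂(μ.prod μ) := by
  have h : MeasurableEmbedding (fun v : ℝ => Real.exp a * v) :=
    (Homeomorph.mulLeft₀ (Real.exp a) (Real.exp_pos a).ne').measurableEmbedding
  rw [dilate, Measure.map_prod_map _ _ (measurable_exp_mul a) (measurable_exp_mul a),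
    (h.prodMap h).integral_map]
  rfl

/-- The trade term tested on `φ`. -/
noncomputable def tradeTerm (p q : ℝ) (φ : ℝ → ℝ) (μ : Measure ℝ) : ℝ :=
  ∫ z : ℝ × ℝ, (φ (p * z.1 + q * z.2) - φ z.1) ∂(μ.prod μ)

lemma tradeTerm_dilate (p q a : ℝ) (φ : ℝ → ℝ) (μ : Measure ℝ) [SFinite μ] :
    tradeTerm p q φ (dilate a μ) = tradeTerm p q (fun v => φ (Real.exp a * v)) μ := by
  rw [tradeTerm, integral_dilate_prod, tradeTerm]
  congr 1; ext z; ring_nf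

/-- Weak solutions of the kinetic equation without drift. -/
structure IsTradeFlow (p q : ℝ) (m : ℝ → Measure ℝ) : Prop where
  prob : ∀ t, 0 ≤ t → IsProbabilityMeasure (m t)
  tendsto_initial : ∀ φ, IsTest φ →
    Tendsto (fun t => ∫ v, φ v ∂(m t)) (𝓝[>] 0) (𝓝 (∫ v, φ v ∂(m 0)))
  hasDerivAt : ∀ φ, IsTest φ → ∀ t, 0 < t →
    HasDerivAt (fun s => ∫ v, φ v ∂(m s)) (tradeTerm p q φ (m t)) t

/-- Dilating a weak solution at the rate of the drift removes the drift. -/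
lemma IsWeakSolution.isTradeFlow {p q : ℝ} {f₀ : Measure ℝ} {g : ℝ → Measure ℝ}
    (hg : IsWeakSolution p q f₀ g) :
    IsTradeFlow p q (fun t => dilate ((p + q - 1) * t) (g t)) where
  prob t ht := by
    have := (hg.isLaw t ht).1
    infer_instance
  tendsto_initial φ hφ := by
    simp only [integral_dilate, mul_zero, Real.exp_zero, one_mul]
    refine tendsto_integral_dilate (fun s hs => (hg.isLaw s hs).1) hφ ?_
    rw [hg.initial]
    exact hg.tendsto_initial φ hφ
  hasDerivAt φ hφ t ht := by
    have := (hg.isLaw t ht.le).1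
    simp only [integral_dilate]
    refine (hasDerivAt_integral_dilate ht (fun s hs => (hg.isLaw s hs).1)
      (fun φ hφ => hg.hasDerivAt φ hφ t ht) hφ).congr_deriv ?_
    rw [tradeTerm_dilate, weakRHS, tradeTerm]
    ring

/-- Dilating a driftless solution gives a weak solution of the equation with drift. -/
lemma IsTradeFlow.isWeakSolution {p q : ℝ} {m : ℝ → Measure ℝ} (hm : IsTradeFlow p q m)
    (hlaw : ∀ t, 0 ≤ t → m t (Iio 0) = 0) :
    IsWeakSolution p q (m 0) (fun t => dilate (-(p + q - 1) * t) (m t)) where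
  isLaw t ht := by
    have := hm.prob t ht
    refine ⟨inferInstance, ?_⟩
    rw [dilate, Measure.map_apply (measurable_exp_mul _) measurableSet_Iio, ← hlaw t ht]
    congr 1
    ext v
    simp [Real.exp_pos]
  initial := by simp [dilate_zero]
  tendsto_initial φ hφ := by
    simp only [integral_dilate]
    exact tendsto_integral_dilate hm.prob hφ (hm.tendsto_initial φ hφ)
  hasDerivAt φ hφ t ht := by
    have := hm.prob t ht.le
    simp only [integral_dilate]
    refine (hasDerivAt_integral_dilate ht hm.prob
      (fun φ hφ => hm.hasDerivAt φ hφ t ht) hφ).congr_deriv ?_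
    rw [weakRHS, ← tradeTerm, tradeTerm_dilate, integral_dilate]
    simp only [deriv_comp_mul_mul φ hφ, dilationGen]
    ring

/-! ### Uniqueness for the driftless equation -/

lemma integrable_comp_trade {μ : Measure (ℝ × ℝ)} [IsFiniteMeasure μ] {φ : ℝ → ℝ}
    (hφ : IsTest φ) (p q : ℝ) : Integrable (fun z : ℝ × ℝ => φ (p * z.1 + q * z.2)) μ := by
  obtain ⟨M, -, hM⟩ := hφ.exists_bound
  exact Integrable.of_bound (hφ.continuous.comp (by fun_prop)).aestronglyMeasurable M
    (Eventually.of_forall fun z => hM _)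

lemma tradeTerm_eq {p q : ℝ} {φ : ℝ → ℝ} (hφ : IsTest φ) (μ : Measure ℝ)
    [IsProbabilityMeasure μ] :
    tradeTerm p q φ μ = (∫ z : ℝ × ℝ, φ (p * z.1 + q * z.2) ∂(μ.prod μ)) - ∫ v, φ v ∂μ := by
  have h2 : Integrable (fun z : ℝ × ℝ => φ z.1) (μ.prod μ) := by
    simpa using integrable_comp_trade hφ 1 0 (μ := μ.prod μ)
  rw [tradeTerm, integral_sub (integrable_comp_trade hφ p q) h2, integral_fun_fst]
  simp

/-- Pass from μ⊗μ to ν⊗ν through ν⊗μ. With the other variable frozen, φ(pv + qw) is again a test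
function bounded by 1, because p and q are nonzero; so each exchange costs ε. -/
lemma integral_trade_sub_le {p q : ℝ} (hp : p ≠ 0) (hq : q ≠ 0) {μ ν : Measure ℝ}
    [IsProbabilityMeasure μ] [IsProbabilityMeasure ν] {ε : ℝ}
    (h : ∀ φ, IsTest φ → (∀ v, |φ v| ≤ 1) → ∫ v, φ v ∂μ - ∫ v, φ v ∂ν ≤ ε)
    {φ : ℝ → ℝ} (hφ : IsTest φ) (h1 : ∀ v, |φ v| ≤ 1) :
    (∫ z : ℝ × ℝ, φ (p * z.1 + q * z.2) ∂(μ.prod μ))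
      - ∫ z : ℝ × ℝ, φ (p * z.1 + q * z.2) ∂(ν.prod ν) ≤ 2 * ε := by
  have e1 : (∫ z : ℝ × ℝ, φ (p * z.1 + q * z.2) ∂(μ.prod μ))
      - ∫ z : ℝ × ℝ, φ (p * z.1 + q * z.2) ∂(ν.prod μ) ≤ ε := by
    rw [integral_prod_symm _ (integrable_comp_trade hφ p q),
      integral_prod_symm _ (integrable_comp_trade hφ p q), ← integral_sub
      (integrable_comp_trade hφ p q).integral_prod_right
      (integrable_comp_trade hφ p q).integral_prod_right]
    calc _ ≤ ∫ _, ε ∂μ := by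
          refine integral_mono (((integrable_comp_trade hφ p q).integral_prod_right).sub
            (integrable_comp_trade hφ p q).integral_prod_right) (integrable_const _) fun w => ?_
          exact h _ (hφ.comp_affine hp (q * w)) fun v => h1 _
      _ = ε := by simp
  have e2 : (∫ z : ℝ × ℝ, φ (p * z.1 + q * z.2) ∂(ν.prod μ))
      - ∫ z : ℝ × ℝ, φ (p * z.1 + q * z.2) ∂(ν.prod ν) ≤ ε := by
    rw [integral_prod _ (integrable_comp_trade hφ p q),
      integral_prod _ (integrable_comp_trade hφ p q), ← integral_sub
      (integrable_comp_trade hφ p q).integral_prod_left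
      (integrable_comp_trade hφ p q).integral_prod_left]
    calc _ ≤ ∫ _, ε ∂ν := by
          refine integral_mono (((integrable_comp_trade hφ p q).integral_prod_left).sub
            (integrable_comp_trade hφ p q).integral_prod_left) (integrable_const _) fun v => ?_
          have := h _ (hφ.comp_affine hq (p * v)) fun v => h1 _
          simpa only [add_comm] using this
      _ = ε := by simp
  linarith

/-- The error bounds of the Picard iterations: each is the integral of c times the previous one. The
rate c is 3 for measures and 2 for Fourier transforms. -/
lemma hasDerivAt_pow_div_factorial (c t : ℝ) (n : ℕ) :
    HasDerivAt (fun t : ℝ => 2 * (c * t) ^ (n + 1) / (n + 1).factorial)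
      (c * (2 * (c * t) ^ n / n.factorial)) t := by
  have h1 : HasDerivAt (fun t : ℝ => c * t) c t := by simpa using (hasDerivAt_id t).const_mul c
  refine (((h1.pow (n + 1)).const_mul 2).div_const _).congr_deriv ?_
  rw [Nat.factorial_succ]
  push_cast
  have : (n.factorial : ℝ) ≠ 0 := by positivity
  field_simp

lemma tendsto_two_mul_pow_div_factorial (x : ℝ) :
    Tendsto (fun n : ℕ => 2 * x ^ n / n.factorial) atTop (𝓝 0) := by
  simpa [mul_div_assoc] using (FloorSemiring.tendsto_pow_div_factorial_atTop x).const_mul 2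

/-- A driftless solution is determined by its initial value. -/
theorem IsTradeFlow.eq {p q : ℝ} (hp : p ≠ 0) (hq : q ≠ 0) {m₁ m₂ : ℝ → Measure ℝ}
    (h₁ : IsTradeFlow p q m₁) (h₂ : IsTradeFlow p q m₂) (h0 : m₁ 0 = m₂ 0) {t : ℝ} (ht : 0 ≤ t) :
    m₁ t = m₂ t := by
  -- The induction starts from the trivial bound 2 for two probability measures. The rate is 3
  -- because an error ε contributes 2ε through the gain term and ε through the loss term.
  have key : ∀ n : ℕ, ∀ φ, IsTest φ → (∀ v, |φ v| ≤ 1) → ∀ t, 0 ≤ t →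
      ∫ v, φ v ∂(m₁ t) - ∫ v, φ v ∂(m₂ t) ≤ 2 * (3 * t) ^ n / n.factorial := by
    intro n
    induction n with
    | zero =>
      intro φ hφ h1 t ht
      have := h₁.prob t ht
      have := h₂.prob t ht
      have a1 := norm_integral_le_of_norm_le_const (μ := m₁ t) (f := φ) (C := 1)
        (Eventually.of_forall h1)
      have a2 := norm_integral_le_of_norm_le_const (μ := m₂ t) (f := φ) (C := 1)
        (Eventually.of_forall h1)
      simp only [Real.norm_eq_abs, probReal_univ, mul_one] at a1 a2
      simp only [pow_zero, Nat.factorial_zero, Nat.cast_one]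
      linarith [abs_le.1 a1, abs_le.1 a2]
    | succ n ih =>
      intro φ hφ h1 t ht
      set D : ℝ → ℝ := fun t => 2 * (3 * t) ^ (n + 1) / (n + 1).factorial
        - (∫ v, φ v ∂(m₁ t) - ∫ v, φ v ∂(m₂ t)) with hD
      have hder : ∀ s, 0 < s → HasDerivAt D (3 * (2 * (3 * s) ^ n / n.factorial)
          - (tradeTerm p q φ (m₁ s) - tradeTerm p q φ (m₂ s))) s := fun s hs =>
        (hasDerivAt_pow_div_factorial 3 s n).sub
          ((h₁.hasDerivAt φ hφ s hs).sub (h₂.hasDerivAt φ hφ s hs))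
      have hcont : ContinuousOn D (Ici 0) := by
        intro s hs
        rcases eq_or_lt_of_le (show (0 : ℝ) ≤ s from hs) with rfl | hs
        -- The equation holds for positive times only; at 0 the initial condition supplies right
        -- continuity.
        · rw [← continuousWithinAt_Ioi_iff_Ici]
          refine ((hasDerivAt_pow_div_factorial 3 0 n).continuousAt.continuousWithinAt).sub ?_
          exact (h₁.tendsto_initial φ hφ).sub (h₂.tendsto_initial φ hφ)
        · exact (hder s hs).continuousAt.continuousWithinAt
      have hmono : MonotoneOn D (Ici 0) := by
        refine monotoneOn_of_deriv_nonneg (convex_Ici 0) hcont ?_ ?_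
        · rw [interior_Ici]
          exact fun s hs => (hder s hs).differentiableAt.differentiableWithinAt
        · rw [interior_Ici]
          intro s hs
          have hs0 : 0 ≤ s := le_of_lt hs
          have := h₁.prob s hs0
          have := h₂.prob s hs0
          rw [(hder s hs).deriv, tradeTerm_eq hφ, tradeTerm_eq hφ]
          have b1 := integral_trade_sub_le hp hq (fun φ hφ h1 => ih φ hφ h1 s hs0) hφ h1
          -- The loss term enters with the opposite sign, so the one-sided hypothesis is applied to
          -- -φ.
          have b2 := ih (fun v => -φ v) hφ.neg (fun v => by simpa using h1 v) s hs0
          rw [integral_neg, integral_neg] at b2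
          linarith
      have := hmono (mem_Ici.2 le_rfl) (mem_Ici.2 ht) ht
      simp only [hD, h0, sub_self, mul_zero, ne_eq, Nat.add_eq_zero_iff, one_ne_zero, and_false,
        not_false_eq_true, zero_pow, zero_div] at this
      linarith
  have := h₁.prob t ht
  have := h₂.prob t ht
  have hle : ∀ φ, IsTest φ → (∀ v, |φ v| ≤ 1) → ∫ v, φ v ∂(m₁ t) - ∫ v, φ v ∂(m₂ t) ≤ 0 :=
    fun φ hφ h1 => ge_of_tendsto' (tendsto_two_mul_pow_div_factorial (3 * t))
      fun n => key n φ hφ h1 t ht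
  refine ext_of_isTest fun φ hφ h1 => ?_
  have b1 := hle φ hφ h1
  have b2 := hle (fun v => -φ v) hφ.neg (fun v => by simpa using h1 v)
  rw [integral_neg, integral_neg] at b2
  linarith

/-- Weak solutions are unique. -/
theorem IsWeakSolution.eq {p q : ℝ} (hp : p ≠ 0) (hq : q ≠ 0) {f₀ : Measure ℝ}
    {g₁ g₂ : ℝ → Measure ℝ} (h₁ : IsWeakSolution p q f₀ g₁) (h₂ : IsWeakSolution p q f₀ g₂)
    {t : ℝ} (ht : 0 ≤ t) : g₁ t = g₂ t := by
  have h := h₁.isTradeFlow.eq hp hq h₂.isTradeFlow (by simp [h₁.initial, h₂.initial]) ht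
  have h' := congrArg (dilate (-((p + q - 1) * t))) h
  simpa only [dilate_dilate, neg_add_cancel, dilate_zero] using h'

lemma isWeakSolution_const {p q : ℝ} {μ : Measure ℝ} (hμ : IsLaw μ) (h : IsStationary p q μ) :
    IsWeakSolution p q μ (fun _ => μ) where
  isLaw _ _ := hμ
  initial := rfl
  tendsto_initial _ _ := tendsto_const_nhds
  hasDerivAt φ hφ t _ := by
    rw [h φ hφ]
    exact hasDerivAt_const t _

lemma isStationary_of_isWeakSolution_const {p q : ℝ} {f₀ μ : Measure ℝ} {g : ℝ → Measure ℝ}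
    (hg : IsWeakSolution p q f₀ g) (h : ∀ t, 0 ≤ t → g t = μ) : IsStationary p q μ := by
  intro φ hφ
  have h1 := hg.hasDerivAt φ hφ 1 one_pos
  have h2 : HasDerivAt (fun s => ∫ v, φ v ∂(g s)) 0 1 := by
    refine (hasDerivAt_const 1 (∫ v, φ v ∂μ)).congr_of_eventuallyEq ?_
    filter_upwards [lt_mem_nhds one_pos] with s hs
    rw [h s hs.le]
  rw [h 1 zero_le_one] at h1
  exact h1.unique h2

/-! ### Power series with coefficients of polynomial growth -/

section Series

variable {E : Type*} [NormedAddCommGroup E] [NormedSpace ℝ E] [CompleteSpace E]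

/-- Dominates the termwise derivative of a power series on |x| ≤ r. Polynomial growth of the
coefficients is allowed because the means of the Wild coefficients are bounded only by a power of n
+ 1. -/
lemma summable_succ_mul_pow (M : ℝ) (k : ℕ) {r : ℝ} (hr0 : 0 < r) (hr1 : r < 1) :
    Summable (fun n : ℕ => (n : ℝ) * r ^ (n - 1) * (M * ((n : ℝ) + 1) ^ k)) := by
  refine (summable_nat_add_iff (f := fun n : ℕ =>
    (n : ℝ) * r ^ (n - 1) * (M * ((n : ℝ) + 1) ^ k)) 1).1 ?_
  have h1 : Summable (fun n : ℕ => ((n + 1 : ℕ) : ℝ) ^ (k + 1) * r ^ (n + 1)) :=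
    (summable_nat_add_iff (f := fun n : ℕ => (n : ℝ) ^ (k + 1) * r ^ n) 1).2
      (summable_pow_mul_geometric_of_norm_lt_one (k + 1)
      (by rwa [Real.norm_eq_abs, abs_of_pos hr0]))
  refine Summable.of_norm_bounded (h1.mul_left (|M| * 2 ^ k * r⁻¹)) fun n => ?_
  simp only [norm_mul, norm_pow, Real.norm_eq_abs, Nat.add_sub_cancel, Nat.abs_cast]
  rw [abs_of_pos hr0, abs_of_pos (show (0 : ℝ) < ((n + 1 : ℕ) : ℝ) + 1 by positivity)]
  push_cast
  have h2 : ((n : ℝ) + 1 + 1) ^ k ≤ 2 ^ k * ((n : ℝ) + 1) ^ k := by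
    rw [← mul_pow]
    gcongr
    linarith [(Nat.cast_nonneg n : (0:ℝ) ≤ n)]
  calc ((n : ℝ) + 1) * r ^ n * (|M| * ((n : ℝ) + 1 + 1) ^ k)
      ≤ ((n : ℝ) + 1) * r ^ n * (|M| * (2 ^ k * ((n : ℝ) + 1) ^ k)) := by gcongr
    _ = |M| * 2 ^ k * r⁻¹ * (((n : ℝ) + 1) ^ (k + 1) * r ^ (n + 1)) := by
      field_simp
      ring

lemma summable_pow_smul {c : ℕ → E} {M : ℝ} {k : ℕ} (hc : ∀ n, ‖c n‖ ≤ M * ((n : ℝ) + 1) ^ k)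
    {x : ℝ} (hx : |x| < 1) : Summable (fun n : ℕ => x ^ n • c n) := by
  obtain ⟨r, hxr, hr1⟩ := exists_between hx
  have hr0 : 0 < r := (abs_nonneg x).trans_lt hxr
  refine (summable_nat_add_iff 1).1 (Summable.of_norm_bounded
    ((summable_nat_add_iff 1).2 (summable_succ_mul_pow M k hr0 hr1)) fun n => ?_)
  rw [norm_smul, norm_pow, Real.norm_eq_abs, Nat.add_sub_cancel]
  gcongr
  · calc |x| ^ (n + 1) ≤ r ^ (n + 1) := by gcongr
      _ ≤ r ^ n := pow_le_pow_of_le_one hr0.le hr1.le (Nat.le_succ n)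
      _ ≤ ((n + 1 : ℕ) : ℝ) * r ^ n := by
        refine le_mul_of_one_le_left (by positivity) ?_
        push_cast
        linarith [(Nat.cast_nonneg n : (0:ℝ) ≤ n)]
  · exact hc _

lemma hasDerivAt_tsum_pow_smul {c : ℕ → E} {M : ℝ} {k : ℕ}
    (hc : ∀ n, ‖c n‖ ≤ M * ((n : ℝ) + 1) ^ k) {x : ℝ} (hx : |x| < 1) :
    HasDerivAt (fun y : ℝ => ∑' n : ℕ, y ^ n • c n)
      (∑' n : ℕ, (((n : ℝ) + 1) * x ^ n) • c (n + 1)) x := by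
  obtain ⟨r, hxr, hr1⟩ := exists_between hx
  have hr0 : 0 < r := (abs_nonneg x).trans_lt hxr
  have hu := summable_succ_mul_pow M k hr0 hr1
  have hbd : ∀ (n : ℕ) (y : ℝ), y ∈ Metric.ball (0 : ℝ) r →
      ‖((n : ℝ) * y ^ (n - 1)) • c n‖ ≤ (n : ℝ) * r ^ (n - 1) * (M * ((n : ℝ) + 1) ^ k) := by
    intro n y hy
    rw [mem_ball_zero_iff, Real.norm_eq_abs] at hy
    rw [norm_smul, norm_mul, norm_pow, Real.norm_eq_abs, Real.norm_eq_abs, Nat.abs_cast]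
    gcongr
    exact hc n
  have hmem : x ∈ Metric.ball (0 : ℝ) r := by rwa [mem_ball_zero_iff]
  have h := hasDerivAt_tsum_of_isPreconnected (g := fun (n : ℕ) (y : ℝ) => y ^ n • c n)
    (g' := fun (n : ℕ) (y : ℝ) => ((n : ℝ) * y ^ (n - 1)) • c n) hu Metric.isOpen_ball
    (convex_ball 0 r).isPreconnected (fun n y _ => (hasDerivAt_pow n y).smul_const (c n)) hbd
    hmem (summable_pow_smul hc hx) hmem
  convert h using 1
  rw [(Summable.of_norm_bounded hu fun n => hbd n x hmem).tsum_eq_zero_add]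
  simp

/-! ### Weights of the Wild sum and their derivatives -/

/-- The weights of the Wild sum. -/
noncomputable def wildWeight (n : ℕ) (t : ℝ) : ℝ := Real.exp (-t) * (1 - Real.exp (-t)) ^ n

lemma one_sub_exp_neg_nonneg {t : ℝ} (ht : 0 ≤ t) : 0 ≤ 1 - Real.exp (-t) := by
  have : Real.exp (-t) ≤ 1 := Real.exp_le_one_iff.2 (by linarith)
  linarith

lemma abs_one_sub_exp_neg_lt {t : ℝ} (ht : 0 ≤ t) : |1 - Real.exp (-t)| < 1 := by
  rw [abs_of_nonneg (one_sub_exp_neg_nonneg ht)]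
  linarith [Real.exp_pos (-t)]

lemma wildWeight_nonneg (n : ℕ) {t : ℝ} (ht : 0 ≤ t) : 0 ≤ wildWeight n t :=
  mul_nonneg (Real.exp_pos _).le (pow_nonneg (one_sub_exp_neg_nonneg ht) n)

lemma hasSum_wildWeight {t : ℝ} (ht : 0 ≤ t) : HasSum (fun n => wildWeight n t) 1 := by
  have h := (hasSum_geometric_of_abs_lt_one (abs_one_sub_exp_neg_lt ht)).mul_left (Real.exp (-t))
  have e : Real.exp (-t) * (1 - (1 - Real.exp (-t)))⁻¹ = 1 := by
    rw [sub_sub_cancel]; exact mul_inv_cancel₀ (Real.exp_pos _).ne'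
  rwa [e] at h

lemma wildWeight_zero (n : ℕ) : wildWeight n 0 = if n = 0 then 1 else 0 := by
  rcases n with _ | n <;> simp [wildWeight]

/-- The convolution identity of the weights. -/
lemma sum_antidiagonal_wildWeight {n : ℕ} {x : ℕ × ℕ}
    (hx : x ∈ Finset.HasAntidiagonal.antidiagonal n) (t : ℝ) :
    wildWeight x.1 t * wildWeight x.2 t = Real.exp (-t) ^ 2 * (1 - Real.exp (-t)) ^ n := by
  rw [← Finset.HasAntidiagonal.mem_antidiagonal.1 hx, pow_add, wildWeight, wildWeight]
  ring

lemma hasDerivAt_exp_neg (t : ℝ) : HasDerivAt (fun s => Real.exp (-s)) (-Real.exp (-t)) t := by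
  simpa using (hasDerivAt_neg t).exp

/-- Put x = 1 - exp(-t) in the power series. The new factor (n+1) exp(-2t)(1 - exp(-t))^n is the sum
of the products of the weights i and j over the n+1 pairs with i + j = n; this is how the quadratic
gain term arises. -/
lemma hasDerivAt_tsum_wildWeight {c : ℕ → E} {M : ℝ} {k : ℕ}
    (hc : ∀ n, ‖c n‖ ≤ M * ((n : ℝ) + 1) ^ k) {t : ℝ} (ht : 0 ≤ t) :
    HasDerivAt (fun s => ∑' n, wildWeight n s • c n)
      ((∑' n : ℕ, (((n : ℝ) + 1) * (Real.exp (-t) ^ 2 * (1 - Real.exp (-t)) ^ n)) • c (n + 1))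
        - ∑' n, wildWeight n t • c n) t := by
  have e : ∀ s, ∑' n, wildWeight n s • c n
      = Real.exp (-s) • ∑' n : ℕ, (1 - Real.exp (-s)) ^ n • c n := by
    intro s
    simp_rw [wildWeight, mul_smul]
    exact tsum_const_smul'' _
  have h1 := hasDerivAt_tsum_pow_smul hc (abs_one_sub_exp_neg_lt ht)
  have h2 : HasDerivAt (fun s => 1 - Real.exp (-s)) (Real.exp (-t)) t := by
    simpa using (hasDerivAt_exp_neg t).const_sub 1
  have h3 := (hasDerivAt_exp_neg t).smul (h1.scomp t h2)
  have h4 : HasDerivAt (fun s => ∑' n, wildWeight n s • c n) _ t :=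
    h3.congr_of_eventuallyEq (Eventually.of_forall e)
  refine h4.congr_deriv ?_
  rw [e t, smul_smul, ← pow_two, ← tsum_const_smul'', neg_smul, ← sub_eq_add_neg]
  simp only [Function.comp_apply, smul_smul]
  congr 2
  ext n
  congr 1
  ring

end Series

/-! ### Wild sums -/

/-- The law of `p V + q W` for independent `V` and `W`. -/
noncomputable def tradeLaw (p q : ℝ) (μ ν : Measure ℝ) : Measure ℝ :=
  (μ.prod ν).map (fun z => p * z.1 + q * z.2)

lemma measurable_trade (p q : ℝ) : Measurable (fun z : ℝ × ℝ => p * z.1 + q * z.2) := by fun_prop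

instance isProbabilityMeasure_tradeLaw (p q : ℝ) (μ ν : Measure ℝ) [IsProbabilityMeasure μ]
    [IsProbabilityMeasure ν] : IsProbabilityMeasure (tradeLaw p q μ ν) :=
  Measure.isProbabilityMeasure_map (measurable_trade p q).aemeasurable

lemma integral_tradeLaw {E : Type*} [NormedAddCommGroup E] [NormedSpace ℝ E] (p q : ℝ)
    (μ ν : Measure ℝ) {F : ℝ → E} (hF : StronglyMeasurable F) :
    ∫ v, F v ∂(tradeLaw p q μ ν) = ∫ z : ℝ × ℝ, F (p * z.1 + q * z.2) ∂(μ.prod ν) :=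
  integral_map (measurable_trade p q).aemeasurable hF.aestronglyMeasurable

/-- The Wild coefficients. -/
noncomputable def wild (p q : ℝ) (f₀ : Measure ℝ) : ℕ → Measure ℝ
  | 0 => f₀
  | n + 1 => ((n : ℝ≥0∞) + 1)⁻¹ • ∑ x ∈ (Finset.HasAntidiagonal.antidiagonal n).attach,
      tradeLaw p q (wild p q f₀ x.1.1) (wild p q f₀ x.1.2)
  decreasing_by
    all_goals
      have := Finset.HasAntidiagonal.mem_antidiagonal.1 x.2
      omega

lemma wild_zero (p q : ℝ) (f₀ : Measure ℝ) : wild p q f₀ 0 = f₀ := by rw [wild]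

lemma wild_succ (p q : ℝ) (f₀ : Measure ℝ) (n : ℕ) :
    wild p q f₀ (n + 1) = ((n : ℝ≥0∞) + 1)⁻¹ • ∑ x ∈ Finset.HasAntidiagonal.antidiagonal n,
      tradeLaw p q (wild p q f₀ x.1) (wild p q f₀ x.2) := by
  rw [wild, Finset.sum_attach (Finset.HasAntidiagonal.antidiagonal n)
    (fun x => tradeLaw p q (wild p q f₀ x.1) (wild p q f₀ x.2))]

lemma lt_succ_of_mem_antidiagonal {n : ℕ} {x : ℕ × ℕ}
    (hx : x ∈ Finset.HasAntidiagonal.antidiagonal n) :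
    x.1 < n + 1 ∧ x.2 < n + 1 := by
  have := Finset.HasAntidiagonal.mem_antidiagonal.1 hx
  omega

section Wild

variable (p q : ℝ) (f₀ : Measure ℝ)

/-- The recursion for integrals against the Wild coefficients. -/
lemma integral_wild_succ {E : Type*} [NormedAddCommGroup E] [NormedSpace ℝ E] {F : ℝ → E} (n : ℕ)
    (hF : ∀ x ∈ Finset.HasAntidiagonal.antidiagonal n,
      Integrable F (tradeLaw p q (wild p q f₀ x.1) (wild p q f₀ x.2))) :
    ((n : ℝ) + 1) • ∫ v, F v ∂(wild p q f₀ (n + 1))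
      = ∑ x ∈ Finset.HasAntidiagonal.antidiagonal n,
        ∫ v, F v ∂(tradeLaw p q (wild p q f₀ x.1) (wild p q f₀ x.2)) := by
  rw [wild_succ, integral_smul_measure, integral_finsetSum_measure hF, smul_smul]
  have : (((n : ℝ≥0∞) + 1)⁻¹).toReal = ((n : ℝ) + 1)⁻¹ := by
    rw [ENNReal.toReal_inv, ENNReal.toReal_add (by finiteness) (by finiteness)]
    simp
  rw [this, mul_inv_cancel₀ (by positivity), one_smul]

lemma integrable_wild_succ {E : Type*} [NormedAddCommGroup E] {F : ℝ → E} (n : ℕ)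
    (hF : ∀ x ∈ Finset.HasAntidiagonal.antidiagonal n,
      Integrable F (tradeLaw p q (wild p q f₀ x.1) (wild p q f₀ x.2))) :
    Integrable F (wild p q f₀ (n + 1)) := by
  rw [wild_succ]
  exact (integrable_finsetSum_measure.2 hF).smul_measure (by simp)

/-- The Wild sum, solving the kinetic equation without drift. -/
noncomputable def wildSum (t : ℝ) : Measure ℝ :=
  Measure.sum fun n => ENNReal.ofReal (wildWeight n t) • wild p q f₀ n

lemma wildSum_zero : wildSum p q f₀ 0 = f₀ := by
  ext s hs
  rw [wildSum, Measure.sum_apply _ hs, tsum_eq_single 0]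
  · simp [wildWeight_zero, wild_zero]
  · intro n hn
    simp [wildWeight_zero, hn]

lemma hasSum_integral_wildSum {E : Type*} [NormedAddCommGroup E] [NormedSpace ℝ E]
    {F : ℝ → E} {t : ℝ} (ht : 0 ≤ t) (hF : Integrable F (wildSum p q f₀ t)) :
    HasSum (fun n => wildWeight n t • ∫ v, F v ∂(wild p q f₀ n)) (∫ v, F v ∂(wildSum p q f₀ t)) := by
  rw [wildSum] at hF ⊢
  have h := hasSum_integral_measure hF
  simpa only [integral_smul_measure, ENNReal.toReal_ofReal (wildWeight_nonneg _ ht)] using h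

variable [IsProbabilityMeasure f₀]

instance isProbabilityMeasure_wild (n : ℕ) : IsProbabilityMeasure (wild p q f₀ n) := by
  induction n using Nat.strong_induction_on with
  | _ n ih =>
    rcases n with _ | n
    · rw [wild_zero]; infer_instance
    · refine ⟨?_⟩
      rw [wild_succ, Measure.smul_apply, Measure.finsetSum_apply, Finset.sum_congr rfl
        (g := fun _ => 1)]
      · simp only [Finset.sum_const, Finset.Nat.card_antidiagonal, nsmul_eq_mul, mul_one,
          smul_eq_mul]
        push_cast
        exact ENNReal.inv_mul_cancel (by simp) (by finiteness)
      · intro x hx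
        have := ih x.1 (lt_succ_of_mem_antidiagonal hx).1
        have := ih x.2 (lt_succ_of_mem_antidiagonal hx).2
        exact measure_univ

lemma tradeLaw_Iio {p q : ℝ} (hp : 0 < p) (hq : 0 < q) {μ ν : Measure ℝ} [SFinite μ] [SFinite ν]
    (hμ : μ (Iio 0) = 0) (hν : ν (Iio 0) = 0) : tradeLaw p q μ ν (Iio 0) = 0 := by
  rw [tradeLaw, Measure.map_apply (measurable_trade p q) measurableSet_Iio]
  refine measure_mono_null (t := (Iio 0 ×ˢ univ) ∪ (univ ×ˢ Iio 0)) ?_ ?_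
  · intro z hz
    by_contra hcon
    simp only [mem_union, mem_prod, mem_Iio, mem_univ, and_true, true_and, not_or, not_lt] at hcon
    have : 0 ≤ p * z.1 + q * z.2 :=
      add_nonneg (mul_nonneg hp.le hcon.1) (mul_nonneg hq.le hcon.2)
    exact absurd hz (not_lt.2 this)
  · rw [measure_union_null_iff, Measure.prod_prod, Measure.prod_prod, hμ, hν]
    simp

lemma wild_Iio {p q : ℝ} (hp : 0 < p) (hq : 0 < q) (hf : f₀ (Iio 0) = 0) (n : ℕ) :
    wild p q f₀ n (Iio 0) = 0 := by
  induction n using Nat.strong_induction_on with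
  | _ n ih =>
    rcases n with _ | n
    · rwa [wild_zero]
    · rw [wild_succ, Measure.smul_apply, Measure.finsetSum_apply, Finset.sum_eq_zero, smul_zero]
      intro x hx
      exact tradeLaw_Iio hp hq (ih x.1 (lt_succ_of_mem_antidiagonal hx).1)
        (ih x.2 (lt_succ_of_mem_antidiagonal hx).2)

lemma isProbabilityMeasure_wildSum {t : ℝ} (ht : 0 ≤ t) :
    IsProbabilityMeasure (wildSum p q f₀ t) := by
  refine ⟨?_⟩
  rw [wildSum, Measure.sum_apply _ MeasurableSet.univ]
  simp only [Measure.smul_apply, measure_univ, smul_eq_mul, mul_one]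
  rw [← ENNReal.ofReal_tsum_of_nonneg (fun n => wildWeight_nonneg n ht)
    (hasSum_wildWeight ht).summable, (hasSum_wildWeight ht).tsum_eq, ENNReal.ofReal_one]

lemma wildSum_Iio {p q : ℝ} (hp : 0 < p) (hq : 0 < q) (hf : f₀ (Iio 0) = 0) (t : ℝ) :
    wildSum p q f₀ t (Iio 0) = 0 := by
  rw [wildSum, Measure.sum_apply _ measurableSet_Iio]
  simp [wild_Iio f₀ hp hq hf]

variable {E : Type*} [NormedAddCommGroup E] [NormedSpace ℝ E]

lemma tradeLaw_wildSum {t : ℝ} (ht : 0 ≤ t) :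
    tradeLaw p q (wildSum p q f₀ t) (wildSum p q f₀ t)
      = Measure.sum fun x : ℕ × ℕ => ENNReal.ofReal (wildWeight x.1 t * wildWeight x.2 t) •
        tradeLaw p q (wild p q f₀ x.1) (wild p q f₀ x.2) := by
  rw [tradeLaw, wildSum, Measure.prod_sum, Measure.map_sum (measurable_trade p q).aemeasurable]
  congr 1
  ext1 x
  rw [Measure.prod_smul_left, Measure.prod_smul_right, Measure.map_smul, Measure.map_smul,
    smul_smul, ENNReal.ofReal_mul (wildWeight_nonneg _ ht), tradeLaw]

/-- Group the double series of pairs (i, j) by n = i + j. The product of the weights depends on n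
alone, and the trade laws of these pairs add up to n+1 times the Wild coefficient n+1. -/
lemma hasSum_integral_tradeLaw_wildSum [CompleteSpace E] {F : ℝ → E} {t : ℝ} (ht : 0 ≤ t)
    (hF : Integrable F (tradeLaw p q (wildSum p q f₀ t) (wildSum p q f₀ t)))
    (hF' : ∀ i j, Integrable F (tradeLaw p q (wild p q f₀ i) (wild p q f₀ j))) :
    HasSum (fun n : ℕ => (((n : ℝ) + 1) * (Real.exp (-t) ^ 2 * (1 - Real.exp (-t)) ^ n)) •
      ∫ v, F v ∂(wild p q f₀ (n + 1)))
      (∫ v, F v ∂(tradeLaw p q (wildSum p q f₀ t) (wildSum p q f₀ t))) := by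
  rw [tradeLaw_wildSum p q f₀ ht] at hF ⊢
  have h := hasSum_integral_measure hF
  rw [← Finset.HasAntidiagonal.sigmaAntidiagonalEquivProd.hasSum_iff] at h
  convert h.sigma (fun n => hasSum_fintype _) using 1
  ext n
  rw [mul_comm, mul_smul, integral_wild_succ p q f₀ n fun x _ => hF' x.1 x.2, Finset.smul_sum,
    ← Finset.sum_coe_sort]
  refine Finset.sum_congr rfl fun x _ => ?_
  simp only [Function.comp_apply, Finset.HasAntidiagonal.sigmaAntidiagonalEquivProd_apply,
    integral_smul_measure, sum_antidiagonal_wildWeight x.2]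
  rw [ENNReal.toReal_ofReal]
  exact mul_nonneg (by positivity) (pow_nonneg (one_sub_exp_neg_nonneg ht) n)

/-- Stated for bounded continuous vector-valued functions, so that it serves test functions and
complex exponentials alike. The derivative is taken within t ≥ 0 because `wildSum` truncates
negative weights at negative times. -/
lemma hasDerivWithinAt_integral_wildSum [CompleteSpace E] [SecondCountableTopology E] {F : ℝ → E}
    (hF : Continuous F) {M : ℝ} (hM : ∀ v, ‖F v‖ ≤ M) {t : ℝ} (ht : 0 ≤ t) :
    HasDerivWithinAt (fun s => ∫ v, F v ∂(wildSum p q f₀ s))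
      ((∫ v, F v ∂(tradeLaw p q (wildSum p q f₀ t) (wildSum p q f₀ t)))
        - ∫ v, F v ∂(wildSum p q f₀ t)) (Ici 0) t := by
  have e : ∀ s ∈ Ici (0 : ℝ), ∫ v, F v ∂(wildSum p q f₀ s)
      = ∑' n, wildWeight n s • ∫ v, F v ∂(wild p q f₀ n) := by
    intro s hs
    have := isProbabilityMeasure_wildSum p q f₀ hs
    exact (hasSum_integral_wildSum p q f₀ hs (integrable_of_bound hF hM)).tsum_eq.symm
  have hc : ∀ n, ‖∫ v, F v ∂(wild p q f₀ n)‖ ≤ M * ((n : ℝ) + 1) ^ 0 := fun n =>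
    (norm_integral_le_of_norm_le_const (Eventually.of_forall hM)).trans (by simp)
  have := isProbabilityMeasure_wildSum p q f₀ ht
  refine ((hasDerivAt_tsum_wildWeight hc ht).hasDerivWithinAt.congr e (e t ht)).congr_deriv ?_
  rw [e t ht, (hasSum_integral_tradeLaw_wildSum p q f₀ ht (integrable_of_bound hF hM)
    (fun i j => integrable_of_bound hF hM)).tsum_eq]

lemma isTradeFlow_wildSum : IsTradeFlow p q (wildSum p q f₀) where
  prob t ht := isProbabilityMeasure_wildSum p q f₀ ht
  tendsto_initial φ hφ := by
    obtain ⟨M, -, hM⟩ := hφ.exists_bound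
    have h := (hasDerivWithinAt_integral_wildSum p q f₀ hφ.continuous hM le_rfl).continuousWithinAt
    exact h.mono Ioi_subset_Ici_self
  hasDerivAt φ hφ t ht := by
    obtain ⟨M, -, hM⟩ := hφ.exists_bound
    have := isProbabilityMeasure_wildSum p q f₀ ht.le
    refine ((hasDerivWithinAt_integral_wildSum p q f₀ hφ.continuous hM ht.le).hasDerivAt
      (Ici_mem_nhds ht)).congr_deriv ?_
    rw [tradeTerm_eq hφ, integral_tradeLaw p q _ _ hφ.continuous.stronglyMeasurable]

end Wild

/-! ### First moments -/

lemma integrable_tradeLaw_iff {E : Type*} [NormedAddCommGroup E] (p q : ℝ)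
    (μ ν : Measure ℝ) {F : ℝ → E} (hF : StronglyMeasurable F) :
    Integrable F (tradeLaw p q μ ν)
      ↔ Integrable (fun z : ℝ × ℝ => F (p * z.1 + q * z.2)) (μ.prod ν) :=
  integrable_map_measure hF.aestronglyMeasurable (measurable_trade p q).aemeasurable

lemma integrable_wildSum {p q : ℝ} {f₀ : Measure ℝ}
    {E : Type*} [NormedAddCommGroup E] {F : ℝ → E} {t : ℝ} (ht : 0 ≤ t)
    (hF : ∀ n, Integrable F (wild p q f₀ n))
    (h : Summable fun n => wildWeight n t * ∫ v, ‖F v‖ ∂(wild p q f₀ n)) :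
    Integrable F (wildSum p q f₀ t) := by
  rw [wildSum]
  refine integrable_sum_measure (fun n => (hF n).smul_measure ENNReal.ofReal_ne_top) ?_
  simpa only [integral_smul_measure, ENNReal.toReal_ofReal (wildWeight_nonneg _ ht)] using! h

section Mean

variable {p q : ℝ} {f₀ : Measure ℝ} [IsProbabilityMeasure f₀]

lemma integrable_id_tradeLaw {μ ν : Measure ℝ} [IsFiniteMeasure μ] [IsFiniteMeasure ν]
    (hμ : Integrable (fun v : ℝ => v) μ) (hν : Integrable (fun v : ℝ => v) ν) :
    Integrable (fun v : ℝ => v) (tradeLaw p q μ ν) :=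
  (integrable_tradeLaw_iff p q μ ν stronglyMeasurable_id).2
    (((hμ.comp_fst ν).const_mul p).add ((hν.comp_snd μ).const_mul q))

lemma integral_id_tradeLaw {μ ν : Measure ℝ} [IsProbabilityMeasure μ] [IsProbabilityMeasure ν]
    (hμ : Integrable (fun v : ℝ => v) μ) (hν : Integrable (fun v : ℝ => v) ν) :
    ∫ v, v ∂(tradeLaw p q μ ν) = p * ∫ v, v ∂μ + q * ∫ v, v ∂ν := by
  rw [integral_tradeLaw p q μ ν (F := fun v => v) stronglyMeasurable_id, integral_add
    ((hμ.comp_fst ν).const_mul p) ((hν.comp_snd μ).const_mul q), integral_const_mul,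
    integral_const_mul, integral_fun_fst (fun v : ℝ => v), integral_fun_snd (fun v : ℝ => v)]
  simp

lemma integrable_id_wild (hf : Integrable (fun v : ℝ => v) f₀) (n : ℕ) :
    Integrable (fun v : ℝ => v) (wild p q f₀ n) := by
  induction n using Nat.strong_induction_on with
  | _ n ih =>
    rcases n with _ | n
    · rwa [wild_zero]
    · refine integrable_wild_succ p q f₀ n fun x hx => integrable_id_tradeLaw
        (ih x.1 (lt_succ_of_mem_antidiagonal hx).1) (ih x.2 (lt_succ_of_mem_antidiagonal hx).2)

lemma mean_wild_succ (hf : Integrable (fun v : ℝ => v) f₀) (n : ℕ) :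
    ((n : ℝ) + 1) * ∫ v, v ∂(wild p q f₀ (n + 1))
      = ∑ x ∈ Finset.HasAntidiagonal.antidiagonal n,
        (p * ∫ v, v ∂(wild p q f₀ x.1) + q * ∫ v, v ∂(wild p q f₀ x.2)) := by
  rw [← smul_eq_mul, integral_wild_succ p q f₀ n fun x _ => integrable_id_tradeLaw
    (integrable_id_wild hf _) (integrable_id_wild hf _)]
  exact Finset.sum_congr rfl fun x _ => integral_id_tradeLaw
    (integrable_id_wild hf _) (integrable_id_wild hf _)

lemma mean_wild_succ_range (hf : Integrable (fun v : ℝ => v) f₀) (n : ℕ) :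
    ((n : ℝ) + 1) * ∫ v, v ∂(wild p q f₀ (n + 1))
      = (p + q) * ∑ i ∈ Finset.range (n + 1), ∫ v, v ∂(wild p q f₀ i) := by
  rw [mean_wild_succ hf, Finset.sum_add_distrib, ← Finset.mul_sum, ← Finset.mul_sum, add_mul,
    ← Finset.Nat.sum_antidiagonal_eq_sum_range_succ (fun i _ => ∫ v, v ∂(wild p q f₀ i)) n]
  congr 2
  exact (Finset.Nat.sum_antidiagonal_swap (n := n)
    (f := fun x => ∫ v, v ∂(wild p q f₀ x.2))).symm

/-- The preceding identity expresses (n+1) times mean n+1 through the sum of all earlier means;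
separating the last summand and using the identity one step earlier leaves a two-term recursion. -/
lemma mean_wild_recursion (hf : Integrable (fun v : ℝ => v) f₀) (n : ℕ) :
    ((n : ℝ) + 1) * ∫ v, v ∂(wild p q f₀ (n + 1))
      = ((n : ℝ) + (p + q)) * ∫ v, v ∂(wild p q f₀ n) := by
  rw [mean_wild_succ_range hf, Finset.sum_range_succ, mul_add, add_mul (n : ℝ)]
  congr 1
  rcases n with _ | n
  · simp
  · rw [← mean_wild_succ_range hf]
    push_cast
    ring

lemma mean_wild_nonneg (hp : 0 < p) (hq : 0 < q) (hf0 : f₀ (Iio 0) = 0) (n : ℕ) :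
    0 ≤ ∫ v, v ∂(wild p q f₀ n) := by
  refine integral_nonneg_of_ae ?_
  have h : ∀ᵐ v ∂(wild p q f₀ n), v ∉ Iio (0 : ℝ) :=
    measure_eq_zero_iff_ae_notMem.1 (wild_Iio f₀ hp hq hf0 n)
  filter_upwards [h] with v hv using not_lt.1 hv

/-- The two-term recursion multiplies the mean by (n + p + q)/(n + 1) ≤ 1 + k/(n + 1) for an integer
k ≥ p + q, and Bernoulli bounds this by ((n + 2)/(n + 1))^k. -/
lemma mean_wild_le (hp : 0 < p) (hq : 0 < q) (hf : IsNormalizedLaw f₀) (n : ℕ) :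
    ∫ v, v ∂(wild p q f₀ n) ≤ ((n : ℝ) + 1) ^ ⌈p + q⌉₊ := by
  set k := ⌈p + q⌉₊
  have hk : p + q ≤ k := Nat.le_ceil _
  induction n with
  | zero => simp [wild_zero, hf.2.2]
  | succ n ih =>
    have hn : (0 : ℝ) < (n : ℝ) + 1 := by positivity
    have h1 := mean_wild_recursion (p := p) (q := q) hf.2.1 n
    have h2 : ∫ v, v ∂(wild p q f₀ (n + 1))
        = (((n : ℝ) + (p + q)) / ((n : ℝ) + 1)) * ∫ v, v ∂(wild p q f₀ n) := by
      field_simp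
      linarith
    have hbern : 1 + (k : ℝ) * (1 / ((n : ℝ) + 1)) ≤ (1 + 1 / ((n : ℝ) + 1)) ^ k :=
      one_add_mul_le_pow (by have : 0 < 1 / ((n : ℝ) + 1) := by positivity
                             linarith) k
    rw [h2]
    push_cast
    calc _ ≤ (1 + (k : ℝ) * (1 / ((n : ℝ) + 1))) * ((n : ℝ) + 1) ^ k := by
          refine mul_le_mul ?_ ih (mean_wild_nonneg hp hq hf.1.2 n) (by positivity)
          rw [div_le_iff₀ hn]
          field_simp
          linarith
      _ ≤ (1 + 1 / ((n : ℝ) + 1)) ^ k * ((n : ℝ) + 1) ^ k := by gcongr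
      _ = ((n : ℝ) + 1 + 1) ^ k := by
          rw [← mul_pow]
          congr 1
          field_simp

lemma norm_mean_wild_le (hp : 0 < p) (hq : 0 < q) (hf : IsNormalizedLaw f₀) (n : ℕ) :
    ‖∫ v, v ∂(wild p q f₀ n)‖ ≤ 1 * ((n : ℝ) + 1) ^ ⌈p + q⌉₊ := by
  rw [Real.norm_eq_abs, abs_of_nonneg (mean_wild_nonneg hp hq hf.1.2 n), one_mul]
  exact mean_wild_le hp hq hf n

lemma summable_wildWeight_mean (hp : 0 < p) (hq : 0 < q) (hf : IsNormalizedLaw f₀) {t : ℝ}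
    (ht : 0 ≤ t) : Summable fun n => wildWeight n t * ∫ v, v ∂(wild p q f₀ n) := by
  have h := (summable_pow_smul (norm_mean_wild_le hp hq hf) (abs_one_sub_exp_neg_lt ht)).mul_left
    (Real.exp (-t))
  simpa only [wildWeight, mul_assoc, smul_eq_mul] using h

/-- The function v is not an admissible test function, so the equation y' = (p + q - 1) y for the
mean is derived from the series. With y(0) = 1 it forces the exponential. -/
lemma tsum_wildWeight_mean (hp : 0 < p) (hq : 0 < q) (hf : IsNormalizedLaw f₀) {t : ℝ}
    (ht : 0 ≤ t) :
    ∑' n, wildWeight n t * ∫ v, v ∂(wild p q f₀ n) = Real.exp ((p + q - 1) * t) := by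
  set y : ℝ → ℝ := fun t => ∑' n, wildWeight n t • ∫ v, v ∂(wild p q f₀ n) with hy
  have hder : ∀ s, 0 ≤ s → HasDerivAt y ((p + q - 1) * y s) s := by
    intro s hs
    refine (hasDerivAt_tsum_wildWeight (norm_mean_wild_le hp hq hf) hs).congr_deriv ?_
    have hw := (hasSum_wildWeight hs)
    have hm := summable_wildWeight_mean hp hq hf hs
    have e1 := tsum_mul_tsum_eq_tsum_sum_antidiagonal_of_summable_norm hm.norm hw.summable.norm
    have e2 := tsum_mul_tsum_eq_tsum_sum_antidiagonal_of_summable_norm hw.summable.norm hm.norm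
    have s1 := (summable_norm_sum_mul_antidiagonal_of_summable_norm hm.norm
      hw.summable.norm).of_norm
    have s2 := (summable_norm_sum_mul_antidiagonal_of_summable_norm hw.summable.norm
      hm.norm).of_norm
    rw [hw.tsum_eq] at e1 e2
    have e3 : ∑' n : ℕ, (((n : ℝ) + 1) * (Real.exp (-s) ^ 2 * (1 - Real.exp (-s)) ^ n))
        • ∫ v, v ∂(wild p q f₀ (n + 1)) = p * y s + q * y s := by
      simp only [hy, smul_eq_mul]
      -- The inserted factors 1 are the total weight; they turn py and qy into Cauchy products that
      -- match the gain series.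
      nth_rewrite 2 [← one_mul (∑' n, wildWeight n s * ∫ v, v ∂(wild p q f₀ n))]
      nth_rewrite 1 [← mul_one (∑' n, wildWeight n s * ∫ v, v ∂(wild p q f₀ n))]
      rw [e1, e2, ← tsum_mul_left, ← tsum_mul_left, ← (s1.mul_left p).tsum_add (s2.mul_left q)]
      refine tsum_congr fun n => ?_
      rw [mul_right_comm, mean_wild_succ hf.2.1, Finset.sum_mul, Finset.mul_sum, Finset.mul_sum,
        ← Finset.sum_add_distrib]
      refine Finset.sum_congr rfl fun x hx => ?_
      rw [← sum_antidiagonal_wildWeight hx]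
      ring
    rw [e3]
    simp only [hy]
    ring
  have hz : ∀ s, 0 ≤ s → HasDerivAt (fun s => y s * Real.exp (-((p + q - 1) * s))) 0 s := by
    intro s hs
    have h2 : HasDerivAt (fun s : ℝ => -((p + q - 1) * s)) (-(p + q - 1)) s := by
      simpa using ((hasDerivAt_id s).const_mul (p + q - 1)).fun_neg
    refine ((hder s hs).mul h2.exp).congr_deriv ?_
    ring
  have hc := constant_of_has_deriv_right_zero (a := 0) (b := t)
    (fun s hs => (hz s hs.1).continuousAt.continuousWithinAt)
    (fun s hs => (hz s hs.1).hasDerivWithinAt) t ⟨ht, le_rfl⟩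
  have h0 : y 0 = 1 := by
    simp only [hy, wildWeight_zero]
    rw [tsum_eq_single 0 (by intro n hn; simp [hn])]
    simp [wild_zero, hf.2.2]
  simp only [h0, mul_zero, neg_zero, Real.exp_zero, mul_one] at hc
  rw [Real.exp_neg, mul_inv_eq_iff_eq_mul₀ (Real.exp_pos _).ne', one_mul] at hc
  exact hc

lemma integral_abs_eq_of_Iio {μ : Measure ℝ} (h : μ (Iio 0) = 0) : ∫ v, |v| ∂μ = ∫ v, v ∂μ := by
  refine integral_congr_ae ?_
  have h : ∀ᵐ v ∂μ, v ∉ Iio (0 : ℝ) := measure_eq_zero_iff_ae_notMem.1 h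
  filter_upwards [h] with v hv using abs_of_nonneg (not_lt.1 hv)

lemma integrable_id_wildSum (hp : 0 < p) (hq : 0 < q) (hf : IsNormalizedLaw f₀) {t : ℝ}
    (ht : 0 ≤ t) : Integrable (fun v : ℝ => v) (wildSum p q f₀ t) := by
  refine integrable_wildSum ht (integrable_id_wild hf.2.1) ?_
  simp only [Real.norm_eq_abs, integral_abs_eq_of_Iio (wild_Iio f₀ hp hq hf.1.2 _)]
  exact summable_wildWeight_mean hp hq hf ht

lemma integral_id_wildSum (hp : 0 < p) (hq : 0 < q) (hf : IsNormalizedLaw f₀) {t : ℝ}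
    (ht : 0 ≤ t) : ∫ v, v ∂(wildSum p q f₀ t) = Real.exp ((p + q - 1) * t) := by
  rw [← tsum_wildWeight_mean hp hq hf ht]
  exact (hasSum_integral_wildSum p q f₀ ht (integrable_id_wildSum hp hq hf ht)).tsum_eq.symm

end Mean

/-! ### Moments of higher order -/

/-- Bernoulli for a/(a+b) = 1 - b/(a+b), multiplied by (a+b)^s, gives (a+b)^s ≤ a^s + s b
(a+b)^(s-1); then use a + b ≤ 2a. -/
lemma add_rpow_le_of_le {a b s : ℝ} (hb : 0 ≤ b) (hba : b ≤ a) (hs : 1 ≤ s) :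
    (a + b) ^ s ≤ a ^ s + s * 2 ^ (s - 1) * (a ^ (s - 1) * b) := by
  have ha : 0 ≤ a := hb.trans hba
  rcases (add_nonneg ha hb).eq_or_lt with h0 | hy
  · have ha0 : a = 0 := by linarith
    have hb0 : b = 0 := by linarith
    simp [ha0, hb0]
  · have hbern := one_add_mul_self_le_rpow_one_add (s := -b / (a + b)) (p := s)
      (by rw [le_div_iff₀ hy]; linarith) hs
    have e : 1 + -b / (a + b) = a / (a + b) := by field_simp; ring
    rw [e, Real.div_rpow ha hy.le, le_div_iff₀ (Real.rpow_pos_of_pos hy s)] at hbern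
    have e2 : (a + b) ^ s = (a + b) ^ (s - 1) * (a + b) := by
      rw [← Real.rpow_add_one hy.ne', sub_add_cancel]
    have e3 : (1 + s * (-b / (a + b))) * (a + b) ^ s = (a + b) ^ s - s * b * (a + b) ^ (s - 1) := by
      rw [e2]; field_simp; ring
    have h2 : (a + b) ^ (s - 1) ≤ 2 ^ (s - 1) * a ^ (s - 1) := by
      rw [← Real.mul_rpow (by norm_num) ha]
      exact Real.rpow_le_rpow hy.le (by linarith) (by linarith)
    have h3 : s * b * (a + b) ^ (s - 1) ≤ s * b * (2 ^ (s - 1) * a ^ (s - 1)) := by gcongr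
    rw [e3] at hbern
    linarith

/-- The pure powers keep coefficient exactly 1, which is what makes p^s + q^s appear in the moment
inequality. All the loss goes into mixed terms of orders 1 and s - 1. -/
lemma add_rpow_le_add_cross {a b s : ℝ} (ha : 0 ≤ a) (hb : 0 ≤ b) (hs : 1 ≤ s) :
    (a + b) ^ s ≤ a ^ s + b ^ s + s * 2 ^ (s - 1) * (a * b ^ (s - 1) + a ^ (s - 1) * b) := by
  have n1 : 0 ≤ s * 2 ^ (s - 1) * (a * b ^ (s - 1)) := by positivity
  have n2 : 0 ≤ s * 2 ^ (s - 1) * (a ^ (s - 1) * b) := by positivity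
  have n3 : 0 ≤ a ^ s := by positivity
  have n4 : 0 ≤ b ^ s := by positivity
  rw [mul_add]
  rcases le_total b a with h | h
  · have := add_rpow_le_of_le hb h hs
    linarith
  · have := add_rpow_le_of_le ha h hs
    rw [add_comm b a, mul_comm (b ^ (s - 1)) a] at this
    linarith

/-- The constant of the mixed terms in the moment of order `s` of a trade. -/
noncomputable def crossConst (p q s : ℝ) : ℝ :=
  s * 2 ^ (s - 1) * (p * q ^ (s - 1) + p ^ (s - 1) * q)

lemma crossConst_pos {p q s : ℝ} (hp : 0 < p) (hq : 0 < q) (hs : 1 ≤ s) : 0 < crossConst p q s := by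
  have : 0 < s := by linarith
  unfold crossConst
  positivity

lemma abs_trade_rpow_le {p q s : ℝ} (hp : 0 < p) (hq : 0 < q) (hs : 1 ≤ s) (v w : ℝ) :
    |p * v + q * w| ^ s ≤ p ^ s * |v| ^ s + q ^ s * |w| ^ s
      + crossConst p q s * (|v| * |w| ^ (s - 1) + |v| ^ (s - 1) * |w|) := by
  have h1 : |p * v + q * w| ≤ p * |v| + q * |w| := by
    refine (abs_add_le _ _).trans ?_
    rw [abs_mul, abs_mul, abs_of_pos hp, abs_of_pos hq]
  refine (Real.rpow_le_rpow (abs_nonneg _) h1 (by linarith)).trans ?_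
  refine (add_rpow_le_add_cross (by positivity) (by positivity) hs).trans ?_
  rw [Real.mul_rpow hp.le (abs_nonneg v), Real.mul_rpow hq.le (abs_nonneg w),
    Real.mul_rpow hp.le (abs_nonneg v), Real.mul_rpow hq.le (abs_nonneg w), crossConst]
  have n1 : 0 ≤ s * 2 ^ (s - 1) * (p * q ^ (s - 1) * (|v| ^ (s - 1) * |w|)) := by positivity
  have n2 : 0 ≤ s * 2 ^ (s - 1) * (p ^ (s - 1) * q * (|v| * |w| ^ (s - 1))) := by positivity
  linarith

/-- Split at |v| = 1/ε: each summand on the right suffices on one side. -/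
lemma abs_rpow_sub_one_le {ε s : ℝ} (hε : 0 < ε) (hs : 1 ≤ s) (v : ℝ) :
    |v| ^ (s - 1) ≤ ε * |v| ^ s + ε ^ (-(s - 1)) := by
  have n1 : 0 ≤ ε ^ (-(s - 1)) := by positivity
  have n2 : 0 ≤ ε * |v| ^ s := by positivity
  have n3 : 0 ≤ |v| ^ (s - 1) := by positivity
  rcases le_total (ε * |v|) 1 with h | h
  · have : |v| ^ (s - 1) ≤ ε ^ (-(s - 1)) := by
      rw [Real.rpow_neg hε.le, ← Real.inv_rpow hε.le]
      refine Real.rpow_le_rpow (abs_nonneg v) ?_ (by linarith)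
      rw [← one_div, le_div_iff₀ hε]
      linarith
    linarith
  · have hv : 0 < |v| := by
      by_contra! hcon
      nlinarith
    have : |v| ^ s = |v| ^ (s - 1) * |v| := by
      rw [← Real.rpow_add_one hv.ne', sub_add_cancel]
    have h2 : |v| ^ (s - 1) * 1 ≤ |v| ^ (s - 1) * (ε * |v|) := by gcongr
    rw [this]
    linarith

lemma continuous_abs_rpow {s : ℝ} (hs : 0 ≤ s) : Continuous (fun v : ℝ => |v| ^ s) :=
  continuous_abs.rpow_const fun _ => Or.inr hs

lemma HasMoment.sub_one {s : ℝ} (hs : 1 ≤ s) {μ : Measure ℝ} [IsFiniteMeasure μ]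
    (h : HasMoment s μ) : HasMoment (s - 1) μ := by
  refine Integrable.mono' ((h.const_mul 1).add (integrable_const _))
    (continuous_abs_rpow (by linarith)).aestronglyMeasurable
    (Eventually.of_forall fun v => ?_) (g := fun v => 1 * |v| ^ s + 1 ^ (-(s - 1)))
  rw [Real.norm_eq_abs, abs_of_nonneg (by positivity)]
  exact abs_rpow_sub_one_le one_pos hs v

lemma moment_nonneg (s : ℝ) (μ : Measure ℝ) : 0 ≤ moment s μ :=
  integral_nonneg fun _ => by positivity

lemma moment_sub_one_le {s ε : ℝ} (hs : 1 ≤ s) (hε : 0 < ε) {μ : Measure ℝ}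
    [IsProbabilityMeasure μ] (h : HasMoment s μ) :
    moment (s - 1) μ ≤ ε * moment s μ + ε ^ (-(s - 1)) := by
  have h2 : Integrable (fun v => ε * |v| ^ s + ε ^ (-(s - 1))) μ :=
    (h.const_mul ε).add (integrable_const _)
  calc moment (s - 1) μ ≤ ∫ v, (ε * |v| ^ s + ε ^ (-(s - 1))) ∂μ :=
        integral_mono (h.sub_one hs) h2 fun v => abs_rpow_sub_one_le hε hs v
    _ = _ := by
        rw [integral_add (h.const_mul ε) (integrable_const _), integral_const_mul]
        simp [moment]

section Trade

variable {p q s : ℝ} {μ ν : Measure ℝ} [IsProbabilityMeasure μ] [IsProbabilityMeasure ν]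

lemma integrable_trade_bound (hs : 1 ≤ s)
    (hμ : HasMoment s μ) (hν : HasMoment s ν) (hμ1 : Integrable (fun v : ℝ => v) μ)
    (hν1 : Integrable (fun v : ℝ => v) ν) :
    Integrable (fun z : ℝ × ℝ => p ^ s * |z.1| ^ s + q ^ s * |z.2| ^ s
      + crossConst p q s * (|z.1| * |z.2| ^ (s - 1) + |z.1| ^ (s - 1) * |z.2|)) (μ.prod ν) :=
  (((hμ.comp_fst ν).const_mul _).add ((hν.comp_snd μ).const_mul _)).add
    (((hμ1.abs.mul_prod (hν.sub_one hs)).add ((hμ.sub_one hs).mul_prod hν1.abs)).const_mul _)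

lemma HasMoment.tradeLaw (hp : 0 < p) (hq : 0 < q) (hs : 1 ≤ s)
    (hμ : HasMoment s μ) (hν : HasMoment s ν) (hμ1 : Integrable (fun v : ℝ => v) μ)
    (hν1 : Integrable (fun v : ℝ => v) ν) : HasMoment s (tradeLaw p q μ ν) := by
  have hc : Continuous (fun v : ℝ => |v| ^ s) := continuous_abs_rpow (by linarith)
  rw [HasMoment, integrable_tradeLaw_iff p q μ ν hc.stronglyMeasurable]
  refine Integrable.mono' (integrable_trade_bound (p := p) (q := q) hs hμ hν hμ1 hν1)
    (hc.comp (by fun_prop)).aestronglyMeasurable (Eventually.of_forall fun z => ?_)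
  rw [Real.norm_eq_abs, abs_of_nonneg (by positivity)]
  exact abs_trade_rpow_le hp hq hs z.1 z.2

lemma moment_tradeLaw_le (hp : 0 < p) (hq : 0 < q) (hs : 1 ≤ s)
    (hμ : HasMoment s μ) (hν : HasMoment s ν) (hμ1 : Integrable (fun v : ℝ => v) μ)
    (hν1 : Integrable (fun v : ℝ => v) ν) :
    moment s (tradeLaw p q μ ν) ≤ p ^ s * moment s μ + q ^ s * moment s ν
      + crossConst p q s * ((∫ v, |v| ∂μ) * moment (s - 1) ν
        + moment (s - 1) μ * ∫ v, |v| ∂ν) := by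
  have hc : Continuous (fun v : ℝ => |v| ^ s) := continuous_abs_rpow (by linarith)
  have hint := HasMoment.tradeLaw hp hq hs hμ hν hμ1 hν1
  rw [HasMoment, integrable_tradeLaw_iff p q μ ν hc.stronglyMeasurable] at hint
  rw [moment, integral_tradeLaw p q μ ν hc.stronglyMeasurable]
  refine (integral_mono hint (integrable_trade_bound hs hμ hν hμ1 hν1)
    fun z => abs_trade_rpow_le hp hq hs z.1 z.2).trans_eq ?_
  have i1 := (hμ.comp_fst ν).const_mul (p ^ s)
  have i2 := (hν.comp_snd μ).const_mul (q ^ s)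
  have i3 := hμ1.abs.mul_prod (hν.sub_one hs)
  have i4 := (hμ.sub_one hs).mul_prod hν1.abs
  have i12 : Integrable (fun z : ℝ × ℝ => p ^ s * |z.1| ^ s + q ^ s * |z.2| ^ s) (μ.prod ν) :=
    i1.add i2
  have i34 : Integrable (fun z : ℝ × ℝ => |z.1| * |z.2| ^ (s - 1) + |z.1| ^ (s - 1) * |z.2|)
    (μ.prod ν) := i3.add i4
  rw [integral_add i12 (i34.const_mul _), integral_add i1 i2, integral_const_mul,
    integral_const_mul, integral_const_mul, integral_add i3 i4,
    integral_fun_fst (fun v : ℝ => |v| ^ s), integral_fun_snd (fun v : ℝ => |v| ^ s),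
    integral_prod_mul (fun v : ℝ => |v|) (fun v : ℝ => |v| ^ (s - 1)),
    integral_prod_mul (fun v : ℝ => |v| ^ (s - 1)) (fun v : ℝ => |v|)]
  simp [moment]

end Trade

/-! ### Differential inequality for the moments of partial Wild sums -/

/-- A linear differential inequality with exponential forcing. -/
lemma le_exp_mul_of_deriv_le {y y' : ℝ → ℝ} {σ r K : ℝ} (hr : 0 < r) (hK : 0 ≤ K) (hy0 : 0 ≤ y 0)
    (hder : ∀ t, 0 ≤ t → HasDerivAt y (y' t) t)
    (hle : ∀ t, 0 ≤ t → y' t ≤ (σ - r) * y t + K * Real.exp (σ * t)) {t : ℝ} (ht : 0 ≤ t) :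
    y t ≤ Real.exp (σ * t) * (y 0 + K / r) := by
  have hexp : ∀ c x : ℝ, HasDerivAt (fun x => Real.exp (c * x)) (Real.exp (c * x) * c) x := by
    intro c x
    have : HasDerivAt (fun x : ℝ => c * x) c x := by simpa using (hasDerivAt_id x).const_mul c
    exact this.exp
  -- The function z = exp(-σt) y satisfies z' ≤ -r z + K, so (z - K/r) exp(rt) is nonincreasing.
  set w : ℝ → ℝ := fun t => (Real.exp (-σ * t) * y t - K / r) * Real.exp (r * t) with hw
  have hwd : ∀ x, 0 ≤ x → HasDerivAt w
      (Real.exp (-σ * x) * Real.exp (r * x)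
        * (y' x - ((σ - r) * y x + K * Real.exp (σ * x)))) x := by
    intro x hx
    refine ((((hexp (-σ) x).mul (hder x hx)).sub_const (K / r)).mul (hexp r x)).congr_deriv ?_
    have e : Real.exp (-σ * x) * Real.exp (σ * x) = 1 := by
      rw [← Real.exp_add]; simp
    have e2 : K / r * r = K := by field_simp
    have e3 : Real.exp (-σ * x) * Real.exp (r * x) * (K * Real.exp (σ * x))
        = K * Real.exp (r * x) := by
      calc _ = (Real.exp (-σ * x) * Real.exp (σ * x)) * (K * Real.exp (r * x)) := by ring
        _ = _ := by rw [e, one_mul]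
    rw [mul_sub, mul_add, e3]
    simp only [Pi.mul_apply]
    linear_combination (-Real.exp (r * x)) * e2
  have hanti : AntitoneOn w (Ici 0) := by
    refine antitoneOn_of_deriv_nonpos (convex_Ici 0)
      (fun x hx => (hwd x hx).continuousAt.continuousWithinAt) ?_ ?_
    · rw [interior_Ici]
      exact fun x hx => (hwd x (le_of_lt hx)).differentiableAt.differentiableWithinAt
    · rw [interior_Ici]
      intro x hx
      have hx0 : 0 ≤ x := le_of_lt hx
      rw [(hwd x hx0).deriv]
      exact mul_nonpos_of_nonneg_of_nonpos (by positivity) (by linarith [hle x hx0])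
  have h := hanti (mem_Ici.2 le_rfl) (mem_Ici.2 ht) ht
  simp only [hw, mul_zero, Real.exp_zero, one_mul, mul_one] at h
  have hE : 1 ≤ Real.exp (r * t) := Real.one_le_exp (by positivity)
  have hKr : 0 ≤ K / r := by positivity
  have h1 : Real.exp (-σ * t) * y t - K / r ≤ y 0 := by
    by_contra! hcon
    have : y 0 * Real.exp (r * t) < (Real.exp (-σ * t) * y t - K / r) * Real.exp (r * t) := by
      gcongr
    nlinarith
  have e : Real.exp (σ * t) * Real.exp (-σ * t) = 1 := by rw [← Real.exp_add]; simp
  calc y t = Real.exp (σ * t) * (Real.exp (-σ * t) * y t) := by rw [← mul_assoc, e, one_mul]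
    _ ≤ _ := by gcongr; linarith

/-- The triangle i + j < N lies in the square of side N + 1. For nonnegative terms this bounds the
truncated gain by a product of partial sums. -/
lemma sum_antidiagonal_le_sum_product {f : ℕ × ℕ → ℝ} (hf : ∀ x, 0 ≤ f x) (N : ℕ) :
    ∑ n ∈ Finset.range N, ∑ x ∈ Finset.HasAntidiagonal.antidiagonal n, f x
      ≤ ∑ x ∈ Finset.range (N + 1) ×ˢ Finset.range (N + 1), f x := by
  rw [Finset.sum_sigma']
  refine (Finset.sum_of_injOn (fun y => y.2) (t := (Finset.range (N + 1) ×ˢ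
    Finset.range (N + 1)).filter (fun x => x.1 + x.2 < N)) (g := f) ?_ ?_ ?_ ?_).trans_le
    (Finset.sum_le_sum_of_subset_of_nonneg (Finset.filter_subset _ _) fun x _ _ => hf x)
  · rintro ⟨n, x⟩ hx ⟨m, y⟩ hy hxy
    simp only [Finset.coe_sigma, mem_sigma_iff, Finset.mem_coe,
      Finset.HasAntidiagonal.mem_antidiagonal] at hx hy hxy
    subst hxy
    obtain rfl : n = m := hx.2.symm.trans hy.2
    rfl
  · rintro ⟨n, x⟩ hx
    simp only [Finset.coe_sigma, mem_sigma_iff, Finset.mem_coe, Finset.mem_range,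
      Finset.HasAntidiagonal.mem_antidiagonal] at hx
    simp only [Finset.coe_filter, Finset.mem_product, Finset.mem_range, mem_ofPred_eq]
    omega
  · intro x hx hx'
    exfalso
    refine hx' ⟨⟨x.1 + x.2, x⟩, ?_, rfl⟩
    simpa using (Finset.mem_filter.1 hx).2
  · intros; rfl

lemma hasDerivAt_wildWeight_zero (t : ℝ) :
    HasDerivAt (wildWeight 0) (-wildWeight 0 t) t := by
  have e : wildWeight 0 = fun s => Real.exp (-s) := by ext s; simp [wildWeight]
  rw [e]
  exact hasDerivAt_exp_neg t

lemma hasDerivAt_wildWeight_succ (n : ℕ) (t : ℝ) :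
    HasDerivAt (wildWeight (n + 1))
      (((n : ℝ) + 1) * (Real.exp (-t) ^ 2 * (1 - Real.exp (-t)) ^ n) - wildWeight (n + 1) t) t := by
  have h2 : HasDerivAt (fun s => 1 - Real.exp (-s)) (Real.exp (-t)) t := by
    simpa using (hasDerivAt_exp_neg t).const_sub 1
  refine ((hasDerivAt_exp_neg t).mul (h2.pow (n + 1))).congr_deriv ?_
  rw [wildWeight]
  push_cast
  simp only [Pi.pow_apply]
  ring

/-- Finite sums are differentiated because finiteness of the full moment series is not yet known.
The gain stops at n < N, since its term n comes from the coefficient n + 1. -/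
lemma hasDerivAt_sum_wildWeight (b : ℕ → ℝ) (N : ℕ) (t : ℝ) :
    HasDerivAt (fun t => ∑ n ∈ Finset.range (N + 1), wildWeight n t * b n)
      (∑ n ∈ Finset.range N, (Real.exp (-t) ^ 2 * (1 - Real.exp (-t)) ^ n)
          * (((n : ℝ) + 1) * b (n + 1))
        - ∑ n ∈ Finset.range (N + 1), wildWeight n t * b n) t := by
  simp only [Finset.sum_range_succ']
  refine ((HasDerivAt.fun_sum fun n _ => (hasDerivAt_wildWeight_succ n t).mul_const (b (n + 1))).add
    ((hasDerivAt_wildWeight_zero t).mul_const (b 0))).congr_deriv ?_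
  rw [← sub_sub, ← Finset.sum_sub_distrib, neg_mul, ← sub_eq_add_neg]
  congr 1
  exact Finset.sum_congr rfl fun n _ => by ring

section Moments

variable {p q s : ℝ} {f₀ : Measure ℝ} [IsProbabilityMeasure f₀]

lemma hasMoment_wild (hp : 0 < p) (hq : 0 < q) (hs : 1 ≤ s) (hf : Integrable (fun v : ℝ => v) f₀)
    (hfs : HasMoment s f₀) (n : ℕ) : HasMoment s (wild p q f₀ n) := by
  induction n using Nat.strong_induction_on with
  | _ n ih =>
    rcases n with _ | n
    · rwa [wild_zero]
    · exact integrable_wild_succ p q f₀ n fun x hx => HasMoment.tradeLaw hp hq hs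
        (ih x.1 (lt_succ_of_mem_antidiagonal hx).1) (ih x.2 (lt_succ_of_mem_antidiagonal hx).2)
        (integrable_id_wild hf _) (integrable_id_wild hf _)

lemma moment_wild_succ_le (hp : 0 < p) (hq : 0 < q) (hs : 1 ≤ s)
    (hf : Integrable (fun v : ℝ => v) f₀) (hfs : HasMoment s f₀) (n : ℕ) :
    ((n : ℝ) + 1) * moment s (wild p q f₀ (n + 1))
      ≤ ∑ x ∈ Finset.HasAntidiagonal.antidiagonal n,
        (p ^ s * moment s (wild p q f₀ x.1) + q ^ s * moment s (wild p q f₀ x.2)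
          + crossConst p q s * ((∫ v, |v| ∂(wild p q f₀ x.1)) * moment (s - 1) (wild p q f₀ x.2)
            + moment (s - 1) (wild p q f₀ x.1) * ∫ v, |v| ∂(wild p q f₀ x.2))) := by
  have hm := hasMoment_wild hp hq hs hf hfs
  have h1 := integrable_id_wild (p := p) (q := q) hf
  rw [moment, ← smul_eq_mul, integral_wild_succ p q f₀ n fun x _ =>
    HasMoment.tradeLaw hp hq hs (hm _) (hm _) (h1 _) (h1 _)]
  exact Finset.sum_le_sum fun x _ => moment_tradeLaw_le hp hq hs (hm _) (hm _) (h1 _) (h1 _)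

lemma sum_wildWeight_le_one (N : ℕ) {t : ℝ} (ht : 0 ≤ t) :
    ∑ n ∈ Finset.range N, wildWeight n t ≤ 1 :=
  sum_le_hasSum _ (fun n _ => wildWeight_nonneg n ht) (hasSum_wildWeight ht)

lemma sum_wildWeight_abs_le (hp : 0 < p) (hq : 0 < q) (hf : IsNormalizedLaw f₀) (N : ℕ) {t : ℝ}
    (ht : 0 ≤ t) :
    ∑ n ∈ Finset.range N, wildWeight n t * ∫ v, |v| ∂(wild p q f₀ n)
      ≤ Real.exp ((p + q - 1) * t) := by
  simp only [integral_abs_eq_of_Iio (wild_Iio f₀ hp hq hf.1.2 _)]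
  rw [← tsum_wildWeight_mean hp hq hf ht]
  exact (summable_wildWeight_mean hp hq hf ht).sum_le_tsum _ fun n _ =>
    mul_nonneg (wildWeight_nonneg n ht) (mean_wild_nonneg hp hq hf.1.2 n)

/-- The moments of the partial Wild sums satisfy a linear differential inequality. -/
lemma deriv_partial_moment_le (hp : 0 < p) (hq : 0 < q) (hs : 1 ≤ s) (hf : IsNormalizedLaw f₀)
    (hfs : HasMoment s f₀) {ε : ℝ} (hε : 0 < ε) (N : ℕ) {t : ℝ} (ht : 0 ≤ t) :
    ∑ n ∈ Finset.range N, (Real.exp (-t) ^ 2 * (1 - Real.exp (-t)) ^ n)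
        * (((n : ℝ) + 1) * moment s (wild p q f₀ (n + 1)))
      ≤ (p ^ s + q ^ s + 2 * crossConst p q s * ε)
          * (∑ n ∈ Finset.range (N + 1), wildWeight n t * moment s (wild p q f₀ n))
        + 2 * crossConst p q s * ε ^ (-(s - 1)) * Real.exp (s * (p + q - 1) * t) := by
  have hc := crossConst_pos hp hq hs
  set c := crossConst p q s
  set ell := p + q - 1
  have hm := hasMoment_wild hp hq hs hf.2.1 hfs
  set b : ℕ → ℝ := fun n => moment s (wild p q f₀ n) with hb
  set d : ℕ → ℝ := fun n => moment (s - 1) (wild p q f₀ n) with hd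
  set m : ℕ → ℝ := fun n => ∫ v, |v| ∂(wild p q f₀ n) with hmdef
  have hb0 : ∀ n, 0 ≤ b n := fun n => moment_nonneg _ _
  have hd0 : ∀ n, 0 ≤ d n := fun n => moment_nonneg _ _
  have hm0 : ∀ n, 0 ≤ m n := fun n => integral_nonneg fun _ => abs_nonneg _
  have hw0 : ∀ n, 0 ≤ wildWeight n t := fun n => wildWeight_nonneg n ht
  set G : ℕ × ℕ → ℝ := fun x => p ^ s * b x.1 + q ^ s * b x.2 + c * (m x.1 * d x.2 + d x.1 * m x.2)
    with hG
  have hps : 0 < p ^ s := Real.rpow_pos_of_pos hp s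
  have hqs : 0 < q ^ s := Real.rpow_pos_of_pos hq s
  have hG0 : ∀ x, 0 ≤ G x := fun x => by
    have := hb0 x.1
    have := hb0 x.2
    have := hd0 x.1
    have := hd0 x.2
    have := hm0 x.1
    have := hm0 x.2
    simp only [hG]
    positivity
  set S := Finset.range (N + 1)
  set A := ∑ n ∈ S, wildWeight n t with hA
  set y := ∑ n ∈ S, wildWeight n t * b n with hy
  set M := ∑ n ∈ S, wildWeight n t * m n with hM
  set D := ∑ n ∈ S, wildWeight n t * d n with hD
  have hA1 : A ≤ 1 := sum_wildWeight_le_one _ ht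
  have hA0 : 0 ≤ A := Finset.sum_nonneg fun n _ => hw0 n
  have hy0 : 0 ≤ y := Finset.sum_nonneg fun n _ => mul_nonneg (hw0 n) (hb0 n)
  have hM0 : 0 ≤ M := Finset.sum_nonneg fun n _ => mul_nonneg (hw0 n) (hm0 n)
  have hD0 : 0 ≤ D := Finset.sum_nonneg fun n _ => mul_nonneg (hw0 n) (hd0 n)
  have hM1 : M ≤ Real.exp (ell * t) := sum_wildWeight_abs_le hp hq hf _ ht
  have step1 : ∑ n ∈ Finset.range N, (Real.exp (-t) ^ 2 * (1 - Real.exp (-t)) ^ n)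
        * (((n : ℝ) + 1) * b (n + 1))
      ≤ ∑ n ∈ Finset.range N, ∑ x ∈ Finset.HasAntidiagonal.antidiagonal n,
        wildWeight x.1 t * wildWeight x.2 t * G x := by
    refine Finset.sum_le_sum fun n _ => ?_
    calc _ ≤ (Real.exp (-t) ^ 2 * (1 - Real.exp (-t)) ^ n)
          * ∑ x ∈ Finset.HasAntidiagonal.antidiagonal n, G x :=
          mul_le_mul_of_nonneg_left (moment_wild_succ_le hp hq hs hf.2.1 hfs n)
            (mul_nonneg (by positivity) (pow_nonneg (one_sub_exp_neg_nonneg ht) n))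
      _ = _ := by
          rw [Finset.mul_sum]
          exact Finset.sum_congr rfl fun x hx => by rw [sum_antidiagonal_wildWeight hx]
  have step2 : ∑ n ∈ Finset.range N, ∑ x ∈ Finset.HasAntidiagonal.antidiagonal n,
        wildWeight x.1 t * wildWeight x.2 t * G x
      ≤ ∑ x ∈ S ×ˢ S, wildWeight x.1 t * wildWeight x.2 t * G x :=
    sum_antidiagonal_le_sum_product (f := fun x => wildWeight x.1 t * wildWeight x.2 t * G x)
      (fun x => mul_nonneg (mul_nonneg (hw0 _) (hw0 _)) (hG0 x)) N
  have step3 : ∑ x ∈ S ×ˢ S, wildWeight x.1 t * wildWeight x.2 t * G x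
      = p ^ s * (y * A) + q ^ s * (A * y) + c * (M * D + D * M) := by
    rw [hy, hA, hM, hD, Finset.sum_mul_sum, Finset.sum_mul_sum, Finset.sum_mul_sum,
      Finset.sum_mul_sum]
    simp only [← Finset.sum_product', Finset.mul_sum, ← Finset.sum_add_distrib]
    exact Finset.sum_congr rfl fun x _ => by simp only [hG]; ring
  have hDle : D ≤ ε * Real.exp (-(ell * t)) * y + (ε * Real.exp (-(ell * t))) ^ (-(s - 1)) := by
    -- The factor exp(-ℓt) compensates the growth exp(ℓt) of the first moment M, so that M D
    -- contains only ε y.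
    set η := ε * Real.exp (-(ell * t))
    have hη : 0 < η := by positivity
    calc D ≤ ∑ n ∈ S, wildWeight n t * (η * b n + η ^ (-(s - 1))) := by
          exact Finset.sum_le_sum fun n _ =>
            mul_le_mul_of_nonneg_left (moment_sub_one_le hs hη (hm n)) (hw0 n)
      _ = η * y + A * η ^ (-(s - 1)) := by
          simp only [hy, hA, Finset.mul_sum, Finset.sum_mul, ← Finset.sum_add_distrib]
          exact Finset.sum_congr rfl fun n _ => by ring
      _ ≤ _ := by
          have : A * η ^ (-(s - 1)) ≤ 1 * η ^ (-(s - 1)) := by gcongr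
          linarith
  have e1 : Real.exp (ell * t) * Real.exp (-(ell * t)) = 1 := by
    rw [← Real.exp_add]; simp
  have e2 : Real.exp (ell * t) * (ε * Real.exp (-(ell * t))) ^ (-(s - 1))
      = ε ^ (-(s - 1)) * Real.exp (s * ell * t) := by
    rw [Real.mul_rpow hε.le (Real.exp_pos _).le, ← Real.exp_mul, mul_left_comm, ← Real.exp_add]
    congr 2
    ring
  have hMD : M * D ≤ ε * y + ε ^ (-(s - 1)) * Real.exp (s * ell * t) := by
    calc M * D ≤ Real.exp (ell * t) * (ε * Real.exp (-(ell * t)) * y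
            + (ε * Real.exp (-(ell * t))) ^ (-(s - 1))) := by gcongr
      _ = (Real.exp (ell * t) * Real.exp (-(ell * t))) * (ε * y)
            + Real.exp (ell * t) * (ε * Real.exp (-(ell * t))) ^ (-(s - 1)) := by ring
      _ = _ := by rw [e1, e2, one_mul]
  have hAy : y * A ≤ y := mul_le_of_le_one_right hy0 hA1
  calc _ ≤ p ^ s * (y * A) + q ^ s * (A * y) + c * (M * D + D * M) :=
        (step1.trans step2).trans_eq step3
    _ = p ^ s * (y * A) + q ^ s * (y * A) + 2 * c * (M * D) := by ring
    _ ≤ p ^ s * y + q ^ s * y + 2 * c * (ε * y + ε ^ (-(s - 1)) * Real.exp (s * ell * t)) := by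
        gcongr
    _ = _ := by ring

end Moments

/-- The moments of Wild sums of order `s` grow at most like `exp (s (p + q - 1) t)` when the rate
is negative. -/
theorem exists_moment_wildSum_le {p q δ : ℝ} (hp : 0 < p) (hq : 0 < q) (hδ : 0 < δ)
    (hR : rateR p q δ < 0) :
    ∃ C, 0 ≤ C ∧ ∀ f₀ : Measure ℝ, IsNormalizedLaw f₀ → HasMoment (1 + δ) f₀ → ∀ t, 0 ≤ t →
      HasMoment (1 + δ) (wildSum p q f₀ t) ∧ moment (1 + δ) (wildSum p q f₀ t)
        ≤ Real.exp ((1 + δ) * (p + q - 1) * t) * (moment (1 + δ) f₀ + C) := by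
  set s := 1 + δ with hsdef
  have hs : 1 ≤ s := by linarith
  have hc := crossConst_pos hp hq hs
  set R := rateR p q δ with hRdef
  have hRe : p ^ s + q ^ s = 1 + s * (p + q - 1) + R := by
    simp only [hRdef, rateR, ← hsdef]; ring
  set c := crossConst p q s with hcdef
  -- Chosen to spend half of the dissipation |R| on the mixed terms. The resulting K, and hence the
  -- final constant, involves only p, q and δ, neither N nor the initial law.
  set ε := -R / (4 * c) with hεdef
  have hε : 0 < ε := div_pos (by linarith) (by linarith)
  have hcε : 2 * c * ε = -R / 2 := by rw [hεdef]; field_simp; ring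
  set K := 2 * c * ε ^ (-(s - 1)) with hK
  have hK0 : 0 ≤ K := by positivity
  have hr : 0 < -R / 2 := by linarith
  refine ⟨K / (-R / 2), by positivity, fun f₀ hf hfs t ht => ?_⟩
  have hprob : IsProbabilityMeasure f₀ := hf.1.1
  have hpart : ∀ N : ℕ, ∑ n ∈ Finset.range (N + 1), wildWeight n t * moment s (wild p q f₀ n)
      ≤ Real.exp (s * (p + q - 1) * t) * (moment s f₀ + K / (-R / 2)) := by
    intro N
    have hy0 : ∑ n ∈ Finset.range (N + 1), wildWeight n 0 * moment s (wild p q f₀ n)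
        = moment s f₀ := by
      simp [wildWeight_zero, wild_zero]
    have h := le_exp_mul_of_deriv_le
      (y := fun t => ∑ n ∈ Finset.range (N + 1), wildWeight n t * moment s (wild p q f₀ n))
      (σ := s * (p + q - 1)) hr hK0 (by rw [hy0]; exact moment_nonneg _ _)
      (fun t _ => hasDerivAt_sum_wildWeight _ N t) (fun t ht => ?_) ht
    · rwa [hy0] at h
    · have h := deriv_partial_moment_le hp hq hs hf hfs hε N ht
      rw [← hcdef, hcε, hRe, ← hK] at h
      linarith
  have hsum : Summable fun n => wildWeight n t * moment s (wild p q f₀ n) := by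
    refine summable_of_sum_range_le (c := Real.exp (s * (p + q - 1) * t)
      * (moment s f₀ + K / (-R / 2)))
      (fun n => mul_nonneg (wildWeight_nonneg n ht) (moment_nonneg _ _)) fun N => ?_
    refine le_trans ?_ (hpart N)
    rw [Finset.sum_range_succ]
    linarith [mul_nonneg (wildWeight_nonneg N ht) (moment_nonneg s (wild p q f₀ N))]
  have hmom : HasMoment s (wildSum p q f₀ t) := by
    refine integrable_wildSum ht (hasMoment_wild hp hq hs hf.2.1 hfs) ?_
    refine hsum.congr fun n => ?_
    congr 1
    refine integral_congr_ae (Eventually.of_forall fun v => ?_)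
    exact (Real.norm_of_nonneg (by positivity)).symm
  refine ⟨hmom, ?_⟩
  refine le_of_tendsto' ((hasSum_integral_wildSum p q f₀ ht hmom).tendsto_sum_nat.comp
    (tendsto_add_atTop_nat 1)) fun N => hpart N

/-! ### Fourier transforms -/

lemma continuous_fourierKernel (ξ : ℝ) :
    Continuous (fun v : ℝ => Complex.exp (-Complex.I * (ξ : ℂ) * (v : ℂ))) := by fun_prop

lemma norm_fourierKernel (ξ v : ℝ) : ‖Complex.exp (-Complex.I * (ξ : ℂ) * (v : ℂ))‖ = 1 := by
  rw [Complex.norm_exp]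
  simp

lemma fourierLaw_eq_charFun (μ : Measure ℝ) (ξ : ℝ) : fourierLaw μ ξ = charFun μ (-ξ) := by
  rw [fourierLaw, charFun_apply_real]
  congr 1
  ext v
  congr 1
  push_cast
  ring

lemma norm_fourierLaw_le_one (μ : Measure ℝ) [IsProbabilityMeasure μ] (ξ : ℝ) :
    ‖fourierLaw μ ξ‖ ≤ 1 := by
  rw [fourierLaw_eq_charFun]
  exact norm_charFun_le_one (μ := μ) (-ξ)

lemma ext_of_fourierLaw {μ ν : Measure ℝ} [IsFiniteMeasure μ] [IsFiniteMeasure ν]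
    (h : ∀ ξ, fourierLaw μ ξ = fourierLaw ν ξ) : μ = ν := by
  refine Measure.ext_of_charFun (funext fun ξ => ?_)
  have := h (-ξ)
  rwa [fourierLaw_eq_charFun, fourierLaw_eq_charFun, neg_neg] at this

lemma fourierLaw_dilate (a : ℝ) (μ : Measure ℝ) (ξ : ℝ) :
    fourierLaw (dilate a μ) ξ = fourierLaw μ (Real.exp a * ξ) := by
  rw [fourierLaw, integral_dilate, fourierLaw]
  congr 1
  ext v
  congr 1
  push_cast
  ring

lemma fourierLaw_tradeLaw (p q : ℝ) (μ ν : Measure ℝ) [SFinite μ] [SFinite ν] (ξ : ℝ) :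
    fourierLaw (tradeLaw p q μ ν) ξ = fourierLaw μ (p * ξ) * fourierLaw ν (q * ξ) := by
  rw [fourierLaw, integral_tradeLaw p q μ ν (continuous_fourierKernel ξ).stronglyMeasurable,
    fourierLaw, fourierLaw, ← integral_prod_mul]
  congr 1
  ext z
  rw [← Complex.exp_add]
  congr 1
  push_cast
  ring

/-- Solutions of the driftless kinetic equation in Fourier variables. -/
structure IsFourierFlow (p q : ℝ) (Φ : ℝ → ℝ → ℂ) : Prop where
  norm_le : ∀ t, 0 ≤ t → ∀ ξ, ‖Φ t ξ‖ ≤ 1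
  hasDerivWithinAt : ∀ t, 0 ≤ t → ∀ ξ,
    HasDerivWithinAt (fun s => Φ s ξ) (Φ t (p * ξ) * Φ t (q * ξ) - Φ t ξ) (Ici 0) t

lemma isFourierFlow_wildSum (p q : ℝ) (f₀ : Measure ℝ) [IsProbabilityMeasure f₀] :
    IsFourierFlow p q (fun t => fourierLaw (wildSum p q f₀ t)) where
  norm_le t ht ξ := by
    have := isProbabilityMeasure_wildSum p q f₀ ht
    exact norm_fourierLaw_le_one _ ξ
  hasDerivWithinAt t ht ξ := by
    have := isProbabilityMeasure_wildSum p q f₀ ht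
    refine (hasDerivWithinAt_integral_wildSum p q f₀ (continuous_fourierKernel ξ)
      (fun v => (norm_fourierKernel ξ v).le) ht).congr_deriv ?_
    rw [← fourierLaw_tradeLaw, fourierLaw, fourierLaw]

/-- The equation is invariant under time translation and frequency scaling, so a flow can be
restarted at time r in rescaled variables. -/
lemma IsFourierFlow.shift {p q : ℝ} {Φ : ℝ → ℝ → ℂ} (h : IsFourierFlow p q Φ) {r : ℝ}
    (hr : 0 ≤ r) (a : ℝ) : IsFourierFlow p q (fun t ξ => Φ (r + t) (a * ξ)) where
  norm_le t ht ξ := h.norm_le _ (by linarith) _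
  hasDerivWithinAt t ht ξ := by
    have h1 := h.hasDerivWithinAt (r + t) (by linarith) (a * ξ)
    have h2 : HasDerivWithinAt (fun t => r + t) 1 (Ici 0) t :=
      ((hasDerivAt_id t).const_add r).hasDerivWithinAt
    have h3 := h1.scomp t h2 fun x hx => by
      have : (0 : ℝ) ≤ x := hx
      exact mem_Ici.2 (by linarith)
    refine h3.congr_deriv ?_
    rw [one_smul, mul_left_comm a p, mul_left_comm a q]

/-- Two Fourier flows differ at most by the solution of the linear majorant equation. -/
theorem IsFourierFlow.norm_sub_le_majorant {p q : ℝ} {Φ Ψ : ℝ → ℝ → ℂ} (hΦ : IsFourierFlow p q Φ)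
    (hΨ : IsFourierFlow p q Ψ) {W : ℝ → ℝ → ℝ} (hW0 : ∀ t ξ, 0 ≤ W t ξ)
    (hW : ∀ t ξ, HasDerivAt (fun s => W s ξ) (W t (p * ξ) + W t (q * ξ) - W t ξ) t)
    (h0 : ∀ ξ, ‖Φ 0 ξ - Ψ 0 ξ‖ ≤ W 0 ξ) {t : ℝ} (ht : 0 ≤ t) (ξ : ℝ) :
    ‖Φ t ξ - Ψ t ξ‖ ≤ W t ξ := by
  -- Picard iteration with an additive error, starting from the trivial bound 2. The rate is 2
  -- because the gain uses the two frequencies pξ and qξ. No uniformity in ξ of the ratio to W is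
  -- needed.
  have key : ∀ n : ℕ, ∀ t, 0 ≤ t → ∀ ξ, ‖Φ t ξ - Ψ t ξ‖ ≤ W t ξ + 2 * (2 * t) ^ n / n.factorial := by
    intro n
    induction n with
    | zero =>
      intro t ht ξ
      have h1 := norm_sub_le (Φ t ξ) (Ψ t ξ)
      have h2 := hΦ.norm_le t ht ξ
      have h3 := hΨ.norm_le t ht ξ
      simp only [pow_zero, Nat.factorial_zero, Nat.cast_one]
      linarith [hW0 t ξ]
    | succ n ih =>
      intro t ht ξ
      -- The factor exp(s) removes the loss term, so only the difference of the products has to be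
      -- estimated.
      have hder : ∀ x, 0 ≤ x → HasDerivWithinAt (fun s => Real.exp s • (Φ s ξ - Ψ s ξ))
          (Real.exp x • (Φ x (p * ξ) * Φ x (q * ξ) - Ψ x (p * ξ) * Ψ x (q * ξ))) (Ici 0) x := by
        intro x hx
        refine ((Real.hasDerivAt_exp x).hasDerivWithinAt.smul
          ((hΦ.hasDerivWithinAt x hx ξ).sub (hΨ.hasDerivWithinAt x hx ξ))).congr_deriv ?_
        rw [← smul_add]
        congr 1
        simp only [Pi.sub_apply]
        ring
      set B : ℝ → ℝ := fun s => Real.exp s * (W s ξ + 2 * (2 * s) ^ (n + 1) / (n + 1).factorial)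
      have hB : ∀ x, HasDerivAt B (Real.exp x * (W x ξ + 2 * (2 * x) ^ (n + 1) / (n + 1).factorial)
          + Real.exp x * (W x (p * ξ) + W x (q * ξ) - W x ξ
            + 2 * (2 * (2 * x) ^ n / n.factorial))) x := fun x =>
        (Real.hasDerivAt_exp x).mul ((hW x ξ).add (hasDerivAt_pow_div_factorial 2 x n))
      have hmain := image_norm_le_of_norm_deriv_right_le_deriv_boundary (a := 0) (b := t)
        (fun x hx => ((hder x hx.1).continuousWithinAt).mono Icc_subset_Ici_self)
        (fun x hx => (hder x hx.1).mono (Ici_subset_Ici.2 hx.1)) (B := B) ?_ hB ?_ (x := t)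
        ⟨ht, le_rfl⟩
      · rw [norm_smul, Real.norm_of_nonneg (Real.exp_pos t).le] at hmain
        exact le_of_mul_le_mul_left hmain (Real.exp_pos t)
      · simpa [B] using h0 ξ
      · intro x hx
        have hx0 : 0 ≤ x := hx.1
        rw [norm_smul, Real.norm_of_nonneg (Real.exp_pos x).le, ← mul_add]
        refine mul_le_mul_of_nonneg_left ?_ (Real.exp_pos x).le
        have i1 := ih x hx0 (p * ξ)
        have i2 := ih x hx0 (q * ξ)
        have hn : 0 ≤ 2 * (2 * x) ^ (n + 1) / (n + 1).factorial := by positivity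
        have e : Φ x (p * ξ) * Φ x (q * ξ) - Ψ x (p * ξ) * Ψ x (q * ξ)
            = (Φ x (p * ξ) - Ψ x (p * ξ)) * Φ x (q * ξ)
              + Ψ x (p * ξ) * (Φ x (q * ξ) - Ψ x (q * ξ)) := by ring
        have i3 : ‖Φ x (p * ξ) * Φ x (q * ξ) - Ψ x (p * ξ) * Ψ x (q * ξ)‖
            ≤ ‖Φ x (p * ξ) - Ψ x (p * ξ)‖ + ‖Φ x (q * ξ) - Ψ x (q * ξ)‖ := by
          rw [e]
          refine (norm_add_le _ _).trans ?_
          rw [norm_mul, norm_mul]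
          exact add_le_add
            (mul_le_of_le_one_right (norm_nonneg _) (hΦ.norm_le x hx0 _))
            (mul_le_of_le_one_left (norm_nonneg _) (hΨ.norm_le x hx0 _))
        linarith
  have hlim := (tendsto_two_mul_pow_div_factorial (2 * t)).const_add (W t ξ)
  rw [add_zero] at hlim
  exact ge_of_tendsto' hlim fun n => key n t ht ξ

/-! ### Stability of the mean-rescaled flow -/

/-- The solution of the mean-rescaled equation started at `f₀`. -/
noncomputable def wealthFlow (p q : ℝ) (f₀ : Measure ℝ) (t : ℝ) : Measure ℝ :=
  dilate (-(p + q - 1) * t) (wildSum p q f₀ t)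

lemma isWeakSolution_wealthFlow {p q : ℝ} (hp : 0 < p) (hq : 0 < q) {f₀ : Measure ℝ}
    (hf : IsLaw f₀) : IsWeakSolution p q f₀ (wealthFlow p q f₀) := by
  have := hf.1
  have h := (isTradeFlow_wildSum p q f₀).isWeakSolution fun t _ => wildSum_Iio f₀ hp hq hf.2 t
  rwa [wildSum_zero] at h

lemma fourierLaw_wealthFlow (p q : ℝ) (f₀ : Measure ℝ) (t ξ : ℝ) :
    fourierLaw (wealthFlow p q f₀ t) ξ
      = fourierLaw (wildSum p q f₀ t) (Real.exp (-(p + q - 1) * t) * ξ) :=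
  fourierLaw_dilate _ _ _

/-- Stability of Fourier flows in the drift-rescaled variables. -/
lemma IsFourierFlow.norm_sub_le_rate {p q δ : ℝ} (hp : 0 < p) (hq : 0 < q) {Φ Ψ : ℝ → ℝ → ℂ}
    (hΦ : IsFourierFlow p q Φ) (hΨ : IsFourierFlow p q Ψ) {a K : ℝ} (ha : 0 ≤ a) (hK : 0 ≤ K)
    (h0 : ∀ ξ, ‖Φ 0 ξ - Ψ 0 ξ‖ ≤ a * |ξ| + K * |ξ| ^ (1 + δ)) {t : ℝ} (ht : 0 ≤ t) (ξ : ℝ) :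
    ‖Φ t (Real.exp (-(p + q - 1) * t) * ξ) - Ψ t (Real.exp (-(p + q - 1) * t) * ξ)‖
      ≤ a * |ξ| + K * Real.exp (rateR p q δ * t) * |ξ| ^ (1 + δ) := by
  have hexp : ∀ c x : ℝ, HasDerivAt (fun x => Real.exp (c * x)) (Real.exp (c * x) * c) x := by
    intro c x
    have : HasDerivAt (fun x : ℝ => c * x) c x := by simpa using (hasDerivAt_id x).const_mul c
    exact this.exp
  -- A power |ξ|^r is an eigenfunction of the majorant equation with exponent p^r + q^r - 1.
  -- Evaluating at exp(-(p+q-1)t) ξ subtracts r(p+q-1), which leaves 0 for r = 1 and R(δ) for r = 1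
  -- + δ.
  set W : ℝ → ℝ → ℝ := fun t ξ => a * |ξ| * Real.exp ((p + q - 1) * t)
    + K * |ξ| ^ (1 + δ) * Real.exp ((p ^ (1 + δ) + q ^ (1 + δ) - 1) * t) with hWdef
  have h := hΦ.norm_sub_le_majorant hΨ (W := W) (fun t ξ => by positivity) (fun t ξ => ?_)
    (fun ξ => by simpa [hWdef] using h0 ξ) ht (Real.exp (-(p + q - 1) * t) * ξ)
  · refine h.trans_eq ?_
    simp only [hWdef, abs_mul, Real.abs_exp]
    rw [Real.mul_rpow (Real.exp_pos _).le (abs_nonneg ξ), ← Real.exp_mul]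
    have e1 : Real.exp (-(p + q - 1) * t) * Real.exp ((p + q - 1) * t) = 1 := by
      rw [← Real.exp_add, neg_mul, neg_add_cancel, Real.exp_zero]
    have e2 : Real.exp (-(p + q - 1) * t * (1 + δ))
        * Real.exp ((p ^ (1 + δ) + q ^ (1 + δ) - 1) * t) = Real.exp (rateR p q δ * t) := by
      rw [← Real.exp_add, rateR]; ring_nf
    rw [← e2]
    linear_combination (a * |ξ|) * e1
  · refine (((hexp _ t).const_mul (a * |ξ|)).add
      ((hexp _ t).const_mul (K * |ξ| ^ (1 + δ)))).congr_deriv ?_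
    simp only [hWdef, abs_mul, abs_of_pos hp, abs_of_pos hq]
    rw [Real.mul_rpow hp.le (abs_nonneg ξ), Real.mul_rpow hq.le (abs_nonneg ξ)]
    ring

lemma wealthFlow_zero (p q : ℝ) (f₀ : Measure ℝ) : wealthFlow p q f₀ 0 = f₀ := by
  rw [wealthFlow, mul_zero, dilate_zero, wildSum_zero]

/-- Stability of the flow, also between different times. -/
lemma norm_fourierLaw_wealthFlow_sub_le {p q δ : ℝ} (hp : 0 < p) (hq : 0 < q) {f₀ f₁ : Measure ℝ}
    [IsProbabilityMeasure f₀] [IsProbabilityMeasure f₁] {a K r : ℝ} (ha : 0 ≤ a) (hK : 0 ≤ K)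
    (hr : 0 ≤ r) (h0 : ∀ ξ, ‖fourierLaw (wealthFlow p q f₀ r) ξ - fourierLaw f₁ ξ‖
      ≤ a * |ξ| + K * |ξ| ^ (1 + δ)) {t : ℝ} (ht : 0 ≤ t) (ξ : ℝ) :
    ‖fourierLaw (wealthFlow p q f₀ (r + t)) ξ - fourierLaw (wealthFlow p q f₁ t) ξ‖
      ≤ a * |ξ| + K * Real.exp (rateR p q δ * t) * |ξ| ^ (1 + δ) := by
  -- The frequency scale is the dilation accumulated up to time r, so the shifted flow starts at the
  -- transform of the rescaled solution at time r.
  have h := ((isFourierFlow_wildSum p q f₀).shift hr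
    (Real.exp (-(p + q - 1) * r))).norm_sub_le_rate (δ := δ) hp hq (isFourierFlow_wildSum p q f₁)
    ha hK (fun ξ => ?_) ht ξ
  · rwa [← mul_assoc, ← Real.exp_add, ← mul_add, ← fourierLaw_wealthFlow,
      ← fourierLaw_wealthFlow] at h
  · simpa only [wildSum_zero, add_zero, ← fourierLaw_wealthFlow] using h0 ξ

/-! ### Laws with equal means are close at low frequencies -/

/-- For |x| ≤ 1 the Taylor remainder is at most x^2 ≤ |x|^s, which uses s ≤ 2; for |x| ≥ 1 the
trivial bound 2 + |x| is at most 3|x|^s. -/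
lemma norm_fourierKernel_sub_le {s : ℝ} (h1 : 1 ≤ s) (h2 : s ≤ 2) (x : ℝ) :
    ‖Complex.exp (-Complex.I * x) - 1 - -Complex.I * x‖ ≤ 3 * |x| ^ s := by
  have hn : ‖-Complex.I * (x : ℂ)‖ = |x| := by simp
  rcases le_total |x| 1 with h | h
  · have h3 := Complex.norm_exp_sub_one_sub_id_le (x := -Complex.I * x) (by rwa [hn])
    rw [hn] at h3
    have h4 : |x| ^ 2 ≤ |x| ^ s := by
      rcases (abs_nonneg x).eq_or_lt with h0 | h0
      · rw [← h0, Real.zero_rpow (by linarith)]; simp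
      · rw [← Real.rpow_two]
        exact Real.rpow_le_rpow_of_exponent_ge h0 h h2
    have : 0 ≤ |x| ^ s := by positivity
    linarith
  · have h3 : |x| ≤ |x| ^ s := by
      simpa using Real.rpow_le_rpow_of_exponent_le h h1
    have h4 : ‖Complex.exp (-Complex.I * x)‖ = 1 := by
      rw [Complex.norm_exp]; simp
    have h5 := norm_sub_le (Complex.exp (-Complex.I * x) - 1) (-Complex.I * x)
    have h6 := norm_sub_le (Complex.exp (-Complex.I * x)) 1
    rw [hn] at h5
    rw [h4, norm_one] at h6
    linarith

lemma norm_fourierLaw_sub_le {s : ℝ} (h1 : 1 ≤ s) (h2 : s ≤ 2) {μ : Measure ℝ}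
    (hμ : IsNormalizedLaw μ) (hs : HasMoment s μ) (ξ : ℝ) :
    ‖fourierLaw μ ξ - (1 - Complex.I * ξ)‖ ≤ 3 * moment s μ * |ξ| ^ s := by
  have := hμ.1.1
  have i1 : Integrable (fun v : ℝ => Complex.exp (-Complex.I * (ξ : ℂ) * (v : ℂ))) μ :=
    integrable_of_bound (continuous_fourierKernel ξ) fun v => (norm_fourierKernel ξ v).le
  have i2 : Integrable (fun v : ℝ => (v : ℂ)) μ := hμ.2.1.ofReal
  have e : fourierLaw μ ξ - (1 - Complex.I * ξ)
      = ∫ v : ℝ, (Complex.exp (-Complex.I * (ξ : ℂ) * (v : ℂ)) - 1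
        - -Complex.I * ξ * (v : ℂ)) ∂μ := by
    have i3 : Integrable (fun v : ℝ => Complex.exp (-Complex.I * (ξ : ℂ) * (v : ℂ)) - 1) μ :=
      i1.sub (integrable_const _)
    rw [integral_sub i3 (i2.const_mul _), integral_sub i1 (integrable_const _),
      integral_const_mul, integral_complex_ofReal, hμ.2.2,
      fourierLaw]
    simp
    ring
  rw [e]
  have hb : ∀ v : ℝ, ‖Complex.exp (-Complex.I * (ξ : ℂ) * (v : ℂ)) - 1
      - -Complex.I * ξ * (v : ℂ)‖ ≤ 3 * |ξ| ^ s * |v| ^ s := by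
    intro v
    have := norm_fourierKernel_sub_le h1 h2 (ξ * v)
    rw [abs_mul, Real.mul_rpow (abs_nonneg _) (abs_nonneg _)] at this
    push_cast at this
    rwa [← mul_assoc, ← mul_assoc] at this
  refine (norm_integral_le_of_norm_le (hs.const_mul _) (Eventually.of_forall hb)).trans_eq ?_
  rw [integral_const_mul, moment]
  ring

lemma norm_fourierLaw_sub_fourierLaw_le {s : ℝ} (h1 : 1 ≤ s) (h2 : s ≤ 2) {μ ν : Measure ℝ}
    (hμ : IsNormalizedLaw μ) (hμs : HasMoment s μ) (hν : IsNormalizedLaw ν) (hνs : HasMoment s ν)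
    (ξ : ℝ) :
    ‖fourierLaw μ ξ - fourierLaw ν ξ‖ ≤ 3 * (moment s μ + moment s ν) * |ξ| ^ s := by
  have a := norm_fourierLaw_sub_le h1 h2 hμ hμs ξ
  have b := norm_fourierLaw_sub_le h1 h2 hν hνs ξ
  have c := norm_sub_le (fourierLaw μ ξ - (1 - Complex.I * ξ))
    (fourierLaw ν ξ - (1 - Complex.I * ξ))
  rw [sub_sub_sub_cancel_right] at c
  linarith

lemma hasDerivAt_charFun_zero {μ : Measure ℝ} [IsFiniteMeasure μ]
    (hμ : Integrable (fun v : ℝ => v) μ) :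
    HasDerivAt (charFun μ) (Complex.I * ((∫ v, v ∂μ : ℝ) : ℂ)) 0 := by
  have hL : MemLp id ((1 : ℕ) : ℝ≥0∞) μ := by
    rw [Nat.cast_one]; exact memLp_one_iff_integrable.2 hμ
  have h1 := iteratedDeriv_charFun_zero hL
  have h2 : Differentiable ℝ (charFun μ) := (contDiff_charFun hL).differentiable (by simp)
  rw [iteratedDeriv_one] at h1
  have h3 := (h2 0).hasDerivAt
  rw [h1] at h3
  simpa using h3

/-- Two laws with equal means have Fourier transforms which differ by less than any multiple of
`|ξ|` up to a term of order `1 + δ`. -/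
lemma exists_norm_fourierLaw_sub_le {μ ν : Measure ℝ} (hμ : IsNormalizedLaw μ)
    (hν : IsNormalizedLaw ν) {s a : ℝ} (hs : 0 ≤ s) (ha : 0 < a) :
    ∃ K, 0 ≤ K ∧ ∀ ξ, ‖fourierLaw μ ξ - fourierLaw ν ξ‖ ≤ a * |ξ| + K * |ξ| ^ s := by
  have := hμ.1.1
  have := hν.1.1
  have hd := (hasDerivAt_charFun_zero hμ.2.1).sub (hasDerivAt_charFun_zero hν.2.1)
  rw [hμ.2.2, hν.2.2, sub_self, hasDerivAt_iff_isLittleO] at hd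
  have hd' := hd.bound ha
  simp only [Pi.sub_apply, charFun_zero, probReal_univ, sub_self, sub_zero, smul_zero] at hd'
  obtain ⟨ρ, hρ, hball⟩ := Metric.eventually_nhds_iff.1 hd'
  -- Below ρ the equal derivatives at 0 give a|ξ|; above ρ the trivial bound 2 is at most
  -- 2(|ξ|/ρ)^s.
  refine ⟨2 * ρ⁻¹ ^ s, by positivity, fun ξ => ?_⟩
  have n1 : 0 ≤ a * |ξ| := by positivity
  rcases lt_or_ge |ξ| ρ with h | h
  · have h1 := hball (y := -ξ) (by simpa using h)
    rw [← fourierLaw_eq_charFun, ← fourierLaw_eq_charFun, norm_neg, Real.norm_eq_abs] at h1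
    have n2 : 0 ≤ 2 * ρ⁻¹ ^ s * |ξ| ^ s := by positivity
    linarith
  · have h1 := norm_sub_le (fourierLaw μ ξ) (fourierLaw ν ξ)
    have h2 := norm_fourierLaw_le_one μ ξ
    have h3 := norm_fourierLaw_le_one ν ξ
    have h4 : 1 ≤ ρ⁻¹ ^ s * |ξ| ^ s := by
      rw [← Real.mul_rpow (by positivity) (abs_nonneg _)]
      refine Real.one_le_rpow ?_ hs
      rw [inv_mul_eq_div, le_div_iff₀ hρ]
      linarith
    linarith

/-! ### The stationary law -/

/-- Lévy's continuity theorem, including existence of the limit. Continuity at 0 gives tightness,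
Prokhorov a cluster point, and convergence along an ultrafilter identifies its characteristic
function with f. -/
lemma exists_tendsto_of_tendsto_charFun {μs : ℕ → ProbabilityMeasure ℝ} {f : ℝ → ℂ}
    (hf : ContinuousAt f 0)
    (h : ∀ t, Tendsto (fun n => charFun (μs n : Measure ℝ) t) atTop (𝓝 (f t))) :
    ∃ μ : ProbabilityMeasure ℝ, Tendsto μs atTop (𝓝 μ) ∧ ∀ t, charFun (μ : Measure ℝ) t = f t := by
  have htight := isTightMeasureSet_of_tendsto_charFun hf h
  have hcomp : IsCompact (closure (range μs)) := by
    refine isCompact_closure_of_isTightMeasureSet ?_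
    convert htight using 1
    ext ν
    simp
  obtain ⟨μ, -, hμ⟩ := hcomp.exists_mapClusterPt (f := atTop) (u := μs)
    (by rw [le_principal_iff, mem_map]
        exact Eventually.of_forall fun n => subset_closure (mem_range_self n))
  obtain ⟨U, hU, hlim⟩ := mapClusterPt_iff_ultrafilter.1 hμ
  have hchar : ∀ t, charFun (μ : Measure ℝ) t = f t := by
    intro t
    refine tendsto_nhds_unique ?_ ((h t).mono_left hU)
    rw [ProbabilityMeasure.tendsto_iff_forall_integral_rclike_tendsto ℂ] at hlim
    simp_rw [charFun_eq_integral_innerProbChar]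
    exact hlim (BoundedContinuousFunction.innerProbChar t)
  refine ⟨μ, ProbabilityMeasure.tendsto_of_tendsto_charFun fun t => ?_, hchar⟩
  rw [hchar]
  exact h t

lemma integrable_dilate_iff {E : Type*} [NormedAddCommGroup E] (a : ℝ) (μ : Measure ℝ)
    (F : ℝ → E) : Integrable F (dilate a μ) ↔ Integrable (fun v => F (Real.exp a * v)) μ := by
  have h : MeasurableEmbedding (fun v : ℝ => Real.exp a * v) :=
    (Homeomorph.mulLeft₀ (Real.exp a) (Real.exp_pos a).ne').measurableEmbedding
  exact h.integrable_map_iff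

lemma isNormalizedLaw_wealthFlow {p q : ℝ} (hp : 0 < p) (hq : 0 < q) {f₀ : Measure ℝ}
    (hf : IsNormalizedLaw f₀) {t : ℝ} (ht : 0 ≤ t) : IsNormalizedLaw (wealthFlow p q f₀ t) := by
  have := hf.1.1
  refine ⟨(isWeakSolution_wealthFlow hp hq hf.1).isLaw t ht, ?_, ?_⟩
  · rw [wealthFlow, integrable_dilate_iff]
    exact (integrable_id_wildSum hp hq hf ht).const_mul _
  · rw [wealthFlow, integral_dilate, integral_const_mul, integral_id_wildSum hp hq hf ht,
      ← Real.exp_add, neg_mul, neg_add_cancel, Real.exp_zero]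

/-- The moments of the mean-rescaled solution stay bounded. -/
theorem exists_moment_wealthFlow_le {p q δ : ℝ} (hp : 0 < p) (hq : 0 < q) (hδ : 0 < δ)
    (hR : rateR p q δ < 0) :
    ∃ C, 0 ≤ C ∧ ∀ f₀ : Measure ℝ, IsNormalizedLaw f₀ → HasMoment (1 + δ) f₀ → ∀ t, 0 ≤ t →
      HasMoment (1 + δ) (wealthFlow p q f₀ t) ∧
        moment (1 + δ) (wealthFlow p q f₀ t) ≤ moment (1 + δ) f₀ + C := by
  obtain ⟨C, hC, h⟩ := exists_moment_wildSum_le hp hq hδ hR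
  refine ⟨C, hC, fun f₀ hf hfs t ht => ?_⟩
  obtain ⟨h1, h2⟩ := h f₀ hf hfs t ht
  have e : ∀ v : ℝ, |Real.exp (-(p + q - 1) * t) * v| ^ (1 + δ)
      = Real.exp (-((1 + δ) * (p + q - 1) * t)) * |v| ^ (1 + δ) := by
    intro v
    rw [abs_mul, Real.abs_exp, Real.mul_rpow (Real.exp_pos _).le (abs_nonneg v), ← Real.exp_mul]
    congr 2
    ring
  refine ⟨?_, ?_⟩
  · rw [HasMoment, wealthFlow, integrable_dilate_iff]
    simp only [e]
    exact h1.const_mul _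
  · rw [moment, wealthFlow, integral_dilate]
    simp only [e]
    rw [integral_const_mul, ← moment, Real.exp_neg, inv_mul_le_iff₀ (Real.exp_pos _)]
    exact h2

/-- R is convex in δ and R(0) = 0, hence R(θδ) ≤ θR(δ) for 0 < θ ≤ 1. Convexity of x^(1+δ) in δ is
weighted AM-GM between x and x^(1+δ). -/
lemma rateR_neg_of_le {p q δ δ' : ℝ} (hp : 0 < p) (hq : 0 < q) (hδ' : 0 < δ') (h : δ' ≤ δ)
    (hR : rateR p q δ < 0) : rateR p q δ' < 0 := by
  have hδ : 0 < δ := hδ'.trans_le h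
  set θ := δ' / δ with hθ
  have hθ0 : 0 < θ := div_pos hδ' hδ
  have hθ1 : θ ≤ 1 := (div_le_one hδ).2 h
  have hθδ : θ * δ = δ' := by rw [hθ]; field_simp
  have hconv : ∀ x : ℝ, 0 < x → x ^ (1 + δ') ≤ (1 - θ) * x + θ * x ^ (1 + δ) := by
    intro x hx
    have := Real.geom_mean_le_arith_mean2_weighted (w₁ := 1 - θ) (w₂ := θ) (p₁ := x)
      (p₂ := x ^ (1 + δ)) (by linarith) hθ0.le hx.le (by positivity) (by ring)
    rw [← Real.rpow_mul hx.le, ← Real.rpow_add hx] at this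
    convert this using 2
    rw [← hθδ]; ring
  have key : rateR p q δ' ≤ θ * rateR p q δ := by
    have h1 := hconv p hp
    have h2 := hconv q hq
    rw [rateR, rateR, ← hθδ] at *
    linarith
  exact key.trans_lt (mul_neg_of_pos_of_neg hθ0 hR)

lemma HasMoment.mono {s s' : ℝ} (h0 : 0 ≤ s') (h : s' ≤ s) {μ : Measure ℝ} [IsFiniteMeasure μ]
    (hμ : HasMoment s μ) : HasMoment s' μ := by
  refine Integrable.mono' ((integrable_const (1 : ℝ)).add hμ)
    (continuous_abs_rpow h0).aestronglyMeasurable (Eventually.of_forall fun v => ?_)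
  rw [Real.norm_of_nonneg (by positivity), Pi.add_apply]
  have n1 : 0 ≤ |v| ^ s := by positivity
  rcases le_total |v| 1 with hv | hv
  · have := Real.rpow_le_one (abs_nonneg v) hv h0
    linarith
  · have := Real.rpow_le_rpow_of_exponent_le hv h
    linarith

lemma HasMoment.integrable_id {s : ℝ} (hs : 1 ≤ s) {μ : Measure ℝ} [IsFiniteMeasure μ]
    (hμ : HasMoment s μ) : Integrable (fun v : ℝ => v) μ := by
  have h := hμ.mono zero_le_one hs
  simp only [HasMoment, Real.rpow_one] at h
  exact (integrable_norm_iff measurable_id.aestronglyMeasurable).1 h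

/-- Integrals of nonnegative continuous functions are lower semicontinuous under weak convergence.
-/
lemma hasMoment_of_tendsto {s M : ℝ} (hs : 0 ≤ s) {μs : ℕ → ProbabilityMeasure ℝ}
    {μ : ProbabilityMeasure ℝ} (hlim : Tendsto μs atTop (𝓝 μ))
    (hm : ∀ n, HasMoment s (μs n : Measure ℝ)) (hM : ∀ n, moment s (μs n : Measure ℝ) ≤ M) :
    HasMoment s (μ : Measure ℝ) := by
  have hc : Continuous (fun v : ℝ => |v| ^ s) := continuous_abs_rpow hs
  have h := lintegral_le_liminf_lintegral_of_forall_isOpen_measure_le_liminf_measure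
    (μ := (μ : Measure ℝ)) (μs := fun n => (μs n : Measure ℝ)) hc (fun v => by positivity)
    fun G hG => ProbabilityMeasure.le_liminf_measure_open_of_tendsto hlim hG
  have hb : ∀ n, ∫⁻ v, ENNReal.ofReal (|v| ^ s) ∂(μs n : Measure ℝ) ≤ ENNReal.ofReal M := by
    intro n
    rw [← ofReal_integral_eq_lintegral_ofReal (hm n) (Eventually.of_forall fun v => by positivity)]
    exact ENNReal.ofReal_le_ofReal (hM n)
  refine ⟨hc.aestronglyMeasurable, ?_⟩
  rw [hasFiniteIntegral_iff_ofReal (Eventually.of_forall fun v => by positivity)]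
  refine (h.trans ?_).trans_lt (ENNReal.ofReal_lt_top (r := M))
  exact liminf_le_of_frequently_le' (Frequently.of_forall hb)

lemma isNormalizedLaw_dirac_one : IsNormalizedLaw (Measure.dirac (1 : ℝ)) := by
  refine ⟨⟨inferInstance, by simp⟩, ?_, by simp⟩
  exact integrable_dirac (by simp)

lemma hasMoment_dirac_one (s : ℝ) : HasMoment s (Measure.dirac (1 : ℝ)) :=
  integrable_dirac (by simp)

/-- There is a stationary law of mean one with a finite moment of order `1 + δ`. -/
theorem exists_isStationary {p q δ : ℝ} (hp : 0 < p) (hq : 0 < q) (hδ : 0 < δ)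
    (hR : rateR p q δ < 0) :
    ∃ μ : Measure ℝ, IsNormalizedLaw μ ∧ IsStationary p q μ ∧ HasMoment (1 + δ) μ := by
  -- Contraction is run at order 1 + δ' ≤ 2, where equal means and finite moments make the distance
  -- finite. The order 1 + δ is kept only for the moment of the limit.
  set δ' := min δ 1 with hδ'def
  have hδ'0 : 0 < δ' := lt_min hδ one_pos
  have hδ'1 : δ' ≤ 1 := min_le_right _ _
  have hδ'δ : δ' ≤ δ := min_le_left _ _
  have hR' : rateR p q δ' < 0 := rateR_neg_of_le hp hq hδ'0 hδ'δ hR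
  set R' := rateR p q δ'
  set s' := 1 + δ' with hs'
  set f₀ : Measure ℝ := Measure.dirac 1 with hf₀
  have hN := isNormalizedLaw_dirac_one
  set g : ℝ → Measure ℝ := wealthFlow p q f₀ with hg
  have hgN : ∀ t, 0 ≤ t → IsNormalizedLaw (g t) := fun t ht =>
    isNormalizedLaw_wealthFlow hp hq hN ht
  have hgP : ∀ t, 0 ≤ t → IsProbabilityMeasure (g t) := fun t ht => (hgN t ht).1.1
  obtain ⟨C, hC0, hC⟩ := exists_moment_wealthFlow_le hp hq hδ hR
  obtain ⟨C', hC'0, hC'⟩ := exists_moment_wealthFlow_le hp hq hδ'0 hR'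
  have hmom := fun t ht => hC f₀ hN (hasMoment_dirac_one _) t ht
  have hmom' := fun t ht => hC' f₀ hN (hasMoment_dirac_one _) t ht
  set M := moment s' f₀ + C'
  have hM0 : 0 ≤ M := add_nonneg (moment_nonneg _ _) hC'0
  have hlow : ∀ t, 0 ≤ t → ∀ ξ, ‖fourierLaw (g t) ξ - (1 - Complex.I * ξ)‖ ≤ 3 * M * |ξ| ^ s' := by
    intro t ht ξ
    refine (norm_fourierLaw_sub_le (by linarith) (by linarith) (hgN t ht) (hmom' t ht).1 ξ).trans ?_
    have := (hmom' t ht).2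
    gcongr
  set K := 3 * (M + moment s' f₀) with hK
  have hK0 : 0 ≤ K := by
    have := moment_nonneg s' f₀
    positivity
  have hcontr : ∀ r, 0 ≤ r → ∀ t, 0 ≤ t → ∀ ξ, ‖fourierLaw (g (r + t)) ξ - fourierLaw (g t) ξ‖
      ≤ K * Real.exp (R' * t) * |ξ| ^ s' := by
    intro r hr t ht ξ
    have h := norm_fourierLaw_wealthFlow_sub_le (δ := δ') (f₀ := f₀) (f₁ := f₀) hp hq le_rfl hK0 hr
      (fun ξ => ?_) ht ξ
    · simpa only [zero_mul, zero_add] using h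
    · rw [zero_mul, zero_add]
      refine (norm_fourierLaw_sub_fourierLaw_le (by linarith) (by linarith) (hgN r hr)
        (hmom' r hr).1 hN (hasMoment_dirac_one _) ξ).trans ?_
      have := (hmom' r hr).2
      rw [hK]
      gcongr
  have hdecay : ∀ c : ℝ, Tendsto (fun n : ℕ => c * Real.exp (R' * n)) atTop (𝓝 0) := by
    intro c
    have h1 : Tendsto (fun n : ℕ => R' * (n : ℝ)) atTop atBot :=
      tendsto_natCast_atTop_atTop.const_mul_atTop_of_neg hR'
    simpa using (Real.tendsto_exp_atBot.comp h1).const_mul c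
  have hcauchy : ∀ ξ, CauchySeq fun n : ℕ => fourierLaw (g n) ξ := by
    intro ξ
    refine cauchySeq_of_le_geometric (Real.exp R') (K * |ξ| ^ s') (by simpa using hR')
      fun n => ?_
    rw [dist_comm, dist_eq_norm, ← Real.exp_nat_mul]
    have h := hcontr 1 zero_le_one n (Nat.cast_nonneg n) ξ
    rw [add_comm] at h
    push_cast
    refine h.trans_eq ?_
    rw [mul_comm R']
    ring
  choose ψ hψ using fun ξ => cauchySeq_tendsto_of_complete (hcauchy ξ)
  set f : ℝ → ℂ := fun t => ψ (-t) with hf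
  have hchar : ∀ t, Tendsto (fun n : ℕ => charFun (g n) t) atTop (𝓝 (f t)) := by
    intro t
    simpa only [fourierLaw_eq_charFun, neg_neg] using hψ (-t)
  have hfT : ∀ t : ℝ, ‖f t - (1 + Complex.I * t)‖ ≤ 3 * M * |t| ^ s' := by
    intro t
    refine le_of_tendsto' (((hψ (-t)).sub_const (1 + Complex.I * t)).norm) fun n => ?_
    have h := hlow n (Nat.cast_nonneg n) (-t)
    rw [abs_neg] at h
    have e : (1 : ℂ) + Complex.I * t = 1 - Complex.I * ((-t : ℝ) : ℂ) := by push_cast; ring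
    rw [e]
    exact h
  -- Weak convergence alone does not preserve the mean. The low-frequency bound, uniform in time,
  -- passes to the limit and gives f the derivative i at 0. This yields both the continuity needed
  -- for Lévy's theorem and mean 1.
  have hfD : HasDerivAt f Complex.I 0 := by
    have h1 : HasDerivAt (fun t : ℝ => 1 + Complex.I * (t : ℂ)) Complex.I 0 := by
      simpa using ((Complex.ofRealCLM.hasDerivAt (x := (0 : ℝ))).const_mul Complex.I).const_add 1
    have h2 : HasDerivAt (fun t : ℝ => f t - (1 + Complex.I * t)) 0 0 := by
      have h0 : f 0 - (1 + Complex.I * (0 : ℝ)) = 0 := by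
        have := hfT 0
        rw [abs_zero, Real.zero_rpow (by linarith), mul_zero] at this
        exact norm_le_zero_iff.1 this
      rw [hasDerivAt_iff_isLittleO, h0]
      simp only [sub_zero, smul_zero]
      refine Asymptotics.IsBigO.trans_isLittleO (g := fun t : ℝ => |t| ^ s')
        (Asymptotics.IsBigO.of_bound (3 * M) (Eventually.of_forall fun t => ?_)) ?_
      · rw [Real.norm_of_nonneg (by positivity)]
        exact hfT t
      · have e : ∀ t : ℝ, |t| ^ s' = |t| ^ δ' * |t| := by
          intro t
          rcases (abs_nonneg t).eq_or_lt with h0 | h0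
          · rw [← h0, Real.zero_rpow (by linarith), mul_zero]
          · rw [hs', add_comm, Real.rpow_add_one h0.ne']
        simp_rw [e]
        have h3 : Tendsto (fun t : ℝ => |t| ^ δ') (𝓝 0) (𝓝 0) := by
          have := (continuous_abs_rpow hδ'0.le).tendsto 0
          simpa [Real.zero_rpow hδ'0.ne'] using this
        have h4 := ((Asymptotics.isLittleO_one_iff ℝ).2 h3).mul_isBigO
          ((Asymptotics.isBigO_refl (fun t : ℝ => t) (𝓝 0)).norm_left)
        simpa using h4
    have h := h1.add h2
    rw [add_zero] at h
    exact h.congr_of_eventuallyEq (Eventually.of_forall fun t => by simp)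
  let P : ℕ → ProbabilityMeasure ℝ := fun n => ⟨g n, hgP n (Nat.cast_nonneg n)⟩
  obtain ⟨μ, hμlim, hμchar⟩ := exists_tendsto_of_tendsto_charFun (μs := P) hfD.continuousAt hchar
  have hμψ : ∀ ξ, fourierLaw (μ : Measure ℝ) ξ = ψ ξ := by
    intro ξ
    rw [fourierLaw_eq_charFun, hμchar, hf]
    simp
  have hμmom : HasMoment (1 + δ) (μ : Measure ℝ) :=
    hasMoment_of_tendsto (by linarith) hμlim (fun n => (hmom n (Nat.cast_nonneg n)).1)
      fun n => (hmom n (Nat.cast_nonneg n)).2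
  have hμint := hμmom.integrable_id (by linarith)
  have hμlaw : IsLaw (μ : Measure ℝ) := by
    refine ⟨inferInstance, ?_⟩
    have h := ProbabilityMeasure.le_liminf_measure_open_of_tendsto hμlim (isOpen_Iio (a := (0 : ℝ)))
    have h0 : ∀ n, (P n : Measure ℝ) (Iio 0) = 0 := fun n => (hgN n (Nat.cast_nonneg n)).1.2
    simpa [h0] using h
  have hμmean : ∫ v, v ∂(μ : Measure ℝ) = 1 := by
    have h1 := hasDerivAt_charFun_zero hμint
    rw [show charFun (μ : Measure ℝ) = f from funext hμchar] at h1
    have h2 := h1.unique hfD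
    have h3 : ((∫ v, v ∂(μ : Measure ℝ) : ℝ) : ℂ) = 1 :=
      mul_left_cancel₀ Complex.I_ne_zero (h2.trans (mul_one _).symm)
    exact_mod_cast h3
  have hdist : ∀ (n : ℕ) (ξ : ℝ), ‖fourierLaw (g n) ξ - fourierLaw (μ : Measure ℝ) ξ‖
      ≤ K * Real.exp (R' * n) * |ξ| ^ s' := by
    intro n ξ
    rw [hμψ, norm_sub_rev]
    have hl : Tendsto (fun m : ℕ => ‖fourierLaw (g ((m + n : ℕ) : ℝ)) ξ - fourierLaw (g n) ξ‖) atTop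
        (𝓝 ‖ψ ξ - fourierLaw (g n) ξ‖) :=
      ((((hψ ξ).comp (tendsto_add_atTop_nat n))).sub_const _).norm
    refine le_of_tendsto' hl fun m => ?_
    push_cast
    exact hcontr m (Nat.cast_nonneg m) n (Nat.cast_nonneg n) ξ
  -- Compare the flow of μ at time t with g(n + t), then g(n + t) with g(n), then g(n) with μ. Each
  -- of the three distances is at most K exp(R'n)|ξ|^s', and n is arbitrary.
  have hconst : ∀ t, 0 ≤ t → wealthFlow p q (μ : Measure ℝ) t = μ := by
    intro t ht
    have hw := isWeakSolution_wealthFlow hp hq hμlaw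
    have := (hw.isLaw t ht).1
    refine ext_of_fourierLaw fun ξ => ?_
    rw [← sub_eq_zero, ← norm_le_zero_iff]
    refine ge_of_tendsto' (hdecay (3 * K * |ξ| ^ s')) fun n => ?_
    have hn : (0 : ℝ) ≤ n := Nat.cast_nonneg n
    have h1 := norm_fourierLaw_wealthFlow_sub_le (δ := δ') (f₀ := f₀) (f₁ := (μ : Measure ℝ))
      (a := 0) (K := K * Real.exp (R' * n)) hp hq le_rfl (by positivity) hn
      (fun ξ => by rw [zero_mul, zero_add]; exact hdist n ξ) ht ξ
    have h2 := hcontr t ht n hn ξ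
    have h3 := hdist n ξ
    have h4 : K * Real.exp (R' * n) * Real.exp (R' * t) * |ξ| ^ s'
        ≤ K * Real.exp (R' * n) * 1 * |ξ| ^ s' := by
      gcongr
      exact Real.exp_le_one_iff.2 (mul_nonpos_of_nonpos_of_nonneg hR'.le ht)
    rw [zero_mul, zero_add] at h1
    rw [add_comm t] at h2
    set a := fourierLaw (wealthFlow p q (μ : Measure ℝ) t) ξ
    set b := fourierLaw (wealthFlow p q f₀ (n + t)) ξ
    set c := fourierLaw (wealthFlow p q f₀ n) ξ
    have e : a - fourierLaw (μ : Measure ℝ) ξ = -(b - a) + (b - c)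
        + (c - fourierLaw (μ : Measure ℝ) ξ) := by ring
    rw [e]
    refine (norm_add_le _ _).trans ?_
    have h5 := norm_add_le (-(b - a)) (b - c)
    rw [norm_neg] at h5
    linarith
  exact ⟨μ, ⟨hμlaw, hμint, hμmean⟩,
    isStationary_of_isWeakSolution_const (isWeakSolution_wealthFlow hp hq hμlaw) hconst, hμmom⟩

/-! ### Uniqueness of the stationary law and contraction towards it -/

lemma wealthFlow_of_isStationary {p q : ℝ} (hp : 0 < p) (hq : 0 < q) {μ : Measure ℝ}
    (hμ : IsLaw μ) (h : IsStationary p q μ) {t : ℝ} (ht : 0 ≤ t) : wealthFlow p q μ t = μ :=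
  (isWeakSolution_wealthFlow hp hq hμ).eq hp.ne' hq.ne' (isWeakSolution_const hμ h) ht

/-- Stationary laws of mean one are unique. -/
theorem IsStationary.eq {p q δ : ℝ} (hp : 0 < p) (hq : 0 < q) (hδ : 0 < δ)
    (hR : rateR p q δ < 0) {μ ν : Measure ℝ} (hμ : IsNormalizedLaw μ) (hν : IsNormalizedLaw ν)
    (hμs : IsStationary p q μ) (hνs : IsStationary p q ν) : μ = ν := by
  have := hμ.1.1
  have := hν.1.1
  refine ext_of_fourierLaw fun ξ => ?_
  -- Without moments of order 1 + δ the distance of that order may be infinite. A linear term a|ξ|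
  -- is therefore admitted: the flow conserves it, the other term decays, and afterwards a tends to
  -- 0.
  have hle : ∀ a : ℝ, 0 < a → ‖fourierLaw μ ξ - fourierLaw ν ξ‖ ≤ a * |ξ| := by
    intro a ha
    obtain ⟨K, hK, h⟩ := exists_norm_fourierLaw_sub_le hμ hν (s := 1 + δ) (by linarith) ha
    have h1 : Tendsto (fun t : ℝ => rateR p q δ * t) atTop atBot :=
      tendsto_id.const_mul_atTop_of_neg hR
    have h2 : Tendsto (fun t : ℝ => a * |ξ| + K * Real.exp (rateR p q δ * t) * |ξ| ^ (1 + δ))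
        atTop (𝓝 (a * |ξ|)) := by
      simpa using (((Real.tendsto_exp_atBot.comp h1).const_mul K).mul_const
        (|ξ| ^ (1 + δ))).const_add (a * |ξ|)
    refine ge_of_tendsto h2 ?_
    filter_upwards [eventually_ge_atTop 0] with t ht
    have h3 := norm_fourierLaw_wealthFlow_sub_le (f₀ := μ) (f₁ := ν) hp hq ha.le hK
      le_rfl (fun ξ => by rw [wealthFlow_zero]; exact h ξ) ht ξ
    rwa [zero_add, wealthFlow_of_isStationary hp hq hμ.1 hμs ht,
      wealthFlow_of_isStationary hp hq hν.1 hνs ht] at h3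
  have h0 : Tendsto (fun a : ℝ => a * |ξ|) (𝓝[>] 0) (𝓝 0) := by
    have : ContinuousAt (fun a : ℝ => a * |ξ|) 0 := by fun_prop
    have h : Tendsto (fun a : ℝ => a * |ξ|) (𝓝 0) (𝓝 0) := by simpa [ContinuousAt] using this
    exact h.mono_left nhdsWithin_le_nhds
  have h1 : ‖fourierLaw μ ξ - fourierLaw ν ξ‖ ≤ 0 := by
    refine ge_of_tendsto h0 ?_
    filter_upwards [self_mem_nhdsWithin] with a ha using hle a ha
  exact sub_eq_zero.1 (norm_le_zero_iff.1 h1)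

lemma fourierLaw_zero (μ : Measure ℝ) [IsProbabilityMeasure μ] : fourierLaw μ 0 = 1 := by
  simp [fourierLaw]

/-- Contraction of the Fourier metric towards a stationary law. -/
theorem fourierDist_wealthFlow_le {p q δ : ℝ} (hp : 0 < p) (hq : 0 < q)
    {f₀ μ : Measure ℝ} [IsProbabilityMeasure f₀] (hμ : IsLaw μ) (hμs : IsStationary p q μ) {t : ℝ}
    (ht : 0 ≤ t) :
    fourierDist (1 + δ) (wealthFlow p q f₀ t) μ
      ≤ fourierDist (1 + δ) f₀ μ * ENNReal.ofReal (Real.exp (rateR p q δ * t)) := by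
  have := hμ.1
  -- An infinite initial distance stays infinite after multiplication by the positive exponential,
  -- so the bound is trivial; this can only matter for δ > 1 when the laws are normalized with
  -- finite moments of order 1 + δ.
  rcases eq_or_ne (fourierDist (1 + δ) f₀ μ) ⊤ with htop | htop
  · rw [htop, ENNReal.top_mul (by simp [Real.exp_pos])]
    exact le_top
  set D := (fourierDist (1 + δ) f₀ μ).toReal with hD
  have hD0 : 0 ≤ D := ENNReal.toReal_nonneg
  have h0 : ∀ ξ, ‖fourierLaw f₀ ξ - fourierLaw μ ξ‖ ≤ D * |ξ| ^ (1 + δ) := by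
    intro ξ
    rcases eq_or_ne ξ 0 with rfl | hξ
    · rw [fourierLaw_zero, fourierLaw_zero, sub_self, norm_zero]
      positivity
    · have h1 : ENNReal.ofReal (‖fourierLaw f₀ ξ - fourierLaw μ ξ‖ / |ξ| ^ (1 + δ))
          ≤ fourierDist (1 + δ) f₀ μ :=
        le_iSup₂ (f := fun (ξ : ℝ) (_ : ξ ≠ 0) => ENNReal.ofReal
          (‖fourierLaw f₀ ξ - fourierLaw μ ξ‖ / |ξ| ^ (1 + δ))) ξ hξ
      rw [ENNReal.ofReal_le_iff_le_toReal htop] at h1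
      exact (div_le_iff₀ (Real.rpow_pos_of_pos (abs_pos.2 hξ) _)).1 h1
  have hmain := norm_fourierLaw_wealthFlow_sub_le (δ := δ) (f₀ := f₀) (f₁ := μ) (a := 0) hp hq
    le_rfl hD0 le_rfl (fun ξ => by rw [wealthFlow_zero, zero_mul, zero_add]; exact h0 ξ) ht
  rw [← ENNReal.ofReal_toReal htop, ← hD, ← ENNReal.ofReal_mul hD0]
  refine iSup₂_le fun ξ hξ => ENNReal.ofReal_le_ofReal ?_
  have h2 := hmain ξ
  rw [zero_add, zero_mul, zero_add, wealthFlow_of_isStationary hp hq hμ hμs ht] at h2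
  exact (div_le_iff₀ (Real.rpow_pos_of_pos (abs_pos.2 hξ) _)).2 h2

lemma fourierDist_lt_top {s : ℝ} (h1 : 1 ≤ s) (h2 : s ≤ 2) {μ ν : Measure ℝ}
    (hμ : IsNormalizedLaw μ) (hμs : HasMoment s μ) (hν : IsNormalizedLaw ν) (hνs : HasMoment s ν) :
    fourierDist s μ ν < ⊤ := by
  refine lt_of_le_of_lt (iSup₂_le fun ξ hξ => ENNReal.ofReal_le_ofReal ?_)
    (ENNReal.ofReal_lt_top (r := 3 * (moment s μ + moment s ν)))
  exact (div_le_iff₀ (Real.rpow_pos_of_pos (abs_pos.2 hξ) _)).2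
    (norm_fourierLaw_sub_fourierLaw_le h1 h2 hμ hμs hν hνs ξ)

end WealthModel

theorem mainTheorem6 (p q δ : ℝ) (hq : 0 < q) (hqp : q < p) (hδ : 0 < δ)
    (hR : WealthModel.rateR p q δ < 0) :
    ∃ ginf : Measure ℝ,
      -- `ginf` is the unique stationary solution of mean one, and it has a finite moment
      (WealthModel.IsNormalizedLaw ginf ∧ WealthModel.IsStationary p q ginf ∧
        ∀ ν : Measure ℝ, WealthModel.IsNormalizedLaw ν → WealthModel.IsStationary p q ν →
          ν = ginf) ∧
      WealthModel.HasMoment (1 + δ) ginf ∧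
      ∃ C : ℝ, ∀ f₀ : Measure ℝ, WealthModel.IsNormalizedLaw f₀ →
        WealthModel.HasMoment (1 + δ) f₀ →
        -- the weak solution exists and is unique
        ∃ g : ℝ → Measure ℝ,
          (WealthModel.IsWeakSolution p q f₀ g ∧
            ∀ g₁ : ℝ → Measure ℝ, WealthModel.IsWeakSolution p q f₀ g₁ →
              ∀ t, 0 ≤ t → g₁ t = g t) ∧
          -- uniform moment bound
          (∀ t, 0 ≤ t → WealthModel.HasMoment (1 + δ) (g t) ∧
            WealthModel.moment (1 + δ) (g t) ≤ WealthModel.moment (1 + δ) f₀ + C) ∧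
          -- exponential convergence in the Fourier metric
          (∀ t, 0 ≤ t → WealthModel.fourierDist (1 + δ) (g t) ginf ≤
            WealthModel.fourierDist (1 + δ) f₀ ginf *
              ENNReal.ofReal (Real.exp (-|WealthModel.rateR p q δ| * t))) ∧
          (δ ≤ 1 → WealthModel.fourierDist (1 + δ) f₀ ginf < ⊤) := by
  have hp : 0 < p := hq.trans hqp
  obtain ⟨ginf, hN, hS, hM⟩ := WealthModel.exists_isStationary hp hq hδ hR
  obtain ⟨C, -, hC⟩ := WealthModel.exists_moment_wealthFlow_le hp hq hδ hR
  refine ⟨ginf, ⟨hN, hS, fun ν hν hνs => hνs.eq hp hq hδ hR hν hN hS⟩, hM, C, fun f₀ hf hfs => ?_⟩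
  have := hf.1.1
  have hw := WealthModel.isWeakSolution_wealthFlow hp hq hf.1
  refine ⟨WealthModel.wealthFlow p q f₀, ⟨hw, fun g₁ hg₁ t ht => hg₁.eq hp.ne' hq.ne' hw ht⟩,
    hC f₀ hf hfs, fun t ht => ?_, fun h1 => ?_⟩
  · rw [abs_of_neg hR, neg_neg]
    exact WealthModel.fourierDist_wealthFlow_le hp hq hN.1 hS ht
  · exact WealthModel.fourierDist_lt_top (by linarith) (by linarith) hf hfs hN hM
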